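/- All arrangements are finite sets of linear hyperplanes (subspaces of codimension one) in finite-dimensional real vector spaces. For an arrangement $\mathcal A$ in $V$, let $L(\mathcal A)$ be its intersection lattice, i.e. the set of all intersections of hyperplanes of $\mathcal A$ (including $V$ itself) ordered by reverse inclusion, let $L_2(\mathcal A)$ be the set of its elements of codimension $2$, and for $X \in L(\mathcal A)$ let $\mathcal A_X = \{H \in \mathcal A \mid X \subseteq H\}$. An element $X \in L(\mathcal A)$ is modular if $X+Y \in L(\mathcal A)$ for all $Y \in L(\mathcal A)$. With $\ell = \dim V$, the arrangement $\mathcal A$ is supersolvable if $\bigcap_{H \in \mathcal A} H = 0$ and there is a chain $V = X_0 \supsetneq X_1 \supsetneq \dots \supsetneq X_\ell = 0$ of modular elements of $L(\mathcal A)$; it is simplicial if every connected component of $V \setminus \bigcup_{H \in \mathcal A} H$ is an open simplicial cone (the set of linear combinations with positive coefficients of some basis of $V$); it is irreducible if it is not a product, i.e. if there are no decomposition $V = V_1 \oplus V_2$ with $V_1, V_2 \neq 0$ and arrangements $\mathcal A_i$ in $V_i$ such that $\mathcal A = \{H_1 \oplus V_2 \mid H_1 \in \mathcal A_1\} \cup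 \{V_1 \oplus H_2 \mid H_2 \in \mathcal A_2\}$. Two arrangements are lattice-equivalent if their intersection lattices are isomorphic. For $n \geq 3$ let $\mathcal A(2n,1)$ be the arrangement in $\mathbb R^3$ of the $2n$ hyperplanes with normal vectors $$\left(-\sin\tfrac{2\pi k}{2n},\ \cos\tfrac{2\pi k}{2n},\ 0\right), \qquad \left(\cos\tfrac{2\pi(2k+1)}{2n},\ \sin\tfrac{2\pi(2k+1)}{2n},\ 1\right), \qquad 0 \leq k \leq n-1.$$ **Proposition.** Let $\mathcal A$ be an irreducible supersolvable simplicial arrangement in a real vector space $V$ of dimension $3$, let $X \in L_2(\mathcal A)$ be modular, and put $n := |\mathcal A_X|$. Then $n \geq 3$, and there is a subarrangement $\mathcal B \subseteq \mathcal A$ with $\mathcal A_X = \mathcal B_X$ such that $\mathcal B$ is lattice-equivalent to $\mathcal A(2n,1)$. -/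

import Mathlib

/-- A (central) arrangement of hyperplanes in the `K`-vector space `V`: a finite set of linear
subspaces of codimension one. -/
@[ext]
structure HyperplaneArrangement (K V : Type*) [Field K] [AddCommGroup V] [Module K V] where
  hyperplanes : Set (Submodule K V)
  finite : hyperplanes.Finite
  codim_one : ∀ H ∈ hyperplanes, Module.finrank K (V ⧸ H) = 1

namespace HyperplaneArrangement

section Field

variable {K V : Type*} [Field K] [AddCommGroup V] [Module K V]

/-- The number of hyperplanes. -/
noncomputable def card (A : HyperplaneArrangement K V) : ℕ := A.hyperplanes.ncard

/-- The elements of the intersection lattice: all intersections of sets of hyperplanes of `A`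
(the empty intersection being `V`). -/
def flats (A : HyperplaneArrangement K V) : Set (Submodule K V) :=
  {X | ∃ S ⊆ A.hyperplanes, X = sInf S}

/-- The intersection lattice `L(A)`, ordered by reverse inclusion. -/
abbrev IntersectionLattice (A : HyperplaneArrangement K V) : Type _ := (↥A.flats)ᵒᵈ

/-- `L_q(A)`: the elements of the intersection lattice of rank (that is, codimension) `q`. -/
def flatsOfRank (A : HyperplaneArrangement K V) (q : ℕ) : Set (Submodule K V) :=
  {X | X ∈ A.flats ∧ Module.finrank K (V ⧸ X) = q}

/-- The center `T(A)`: the intersection of all hyperplanes. -/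
def center (A : HyperplaneArrangement K V) : Submodule K V := sInf A.hyperplanes

/-- The rank `r(A)`: the codimension of the center. -/
noncomputable def rank (A : HyperplaneArrangement K V) : ℕ := Module.finrank K (V ⧸ A.center)

/-- The localization `A_X`, consisting of the hyperplanes of `A` that contain `X`. -/
def localization (A : HyperplaneArrangement K V) (X : Submodule K V) :
    HyperplaneArrangement K V where
  hyperplanes := {H | H ∈ A.hyperplanes ∧ X ≤ H}
  finite := A.finite.subset fun _ h => h.1
  codim_one := fun H h => A.codim_one H h.1

/-- `B` is a subarrangement of `A`. -/
def IsSubarrangement (B A : HyperplaneArrangement K V) : Prop :=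
  B.hyperplanes ⊆ A.hyperplanes

/-- `X` is a modular element of `L(A)`: `X + Y ∈ L(A)` for all `Y ∈ L(A)`. -/
def IsModular (A : HyperplaneArrangement K V) (X : Submodule K V) : Prop :=
  X ∈ A.flats ∧ ∀ Y ∈ A.flats, X ⊔ Y ∈ A.flats

/-- `A` is supersolvable: with `ℓ = dim V`, the rank of `A` is `ℓ`, and there is a maximal chain
`V = X₀ < X₁ < ⋯ < X_ℓ = T(A)` in `L(A)` (which is ordered by reverse inclusion) consisting of
modular elements. -/
def IsSupersolvable (A : HyperplaneArrangement K V) : Prop :=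
  A.rank = Module.finrank K V ∧
    ∃ X : Fin (Module.finrank K V + 1) → Submodule K V,
      X 0 = ⊤ ∧ X (Fin.last _) = A.center ∧ StrictAnti X ∧ ∀ i, A.IsModular (X i)

/-- `A` is reducible: it is a product `A₁ × A₂` of arrangements with respect to a decomposition
`V = V₁ ⊕ V₂` into nonzero subspaces, where
`A₁ × A₂ = {H₁ ⊕ V₂ | H₁ ∈ A₁} ∪ {V₁ ⊕ H₂ | H₂ ∈ A₂}`. -/
def IsReducible (A : HyperplaneArrangement K V) : Prop :=
  ∃ (V₁ V₂ : Submodule K V) (A₁ : HyperplaneArrangement K V₁) (A₂ : HyperplaneArrangement K V₂),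
    IsCompl V₁ V₂ ∧ V₁ ≠ ⊥ ∧ V₂ ≠ ⊥ ∧
      A.hyperplanes =
        {H | ∃ H₁ ∈ A₁.hyperplanes, H = H₁.map V₁.subtype ⊔ V₂} ∪
        {H | ∃ H₂ ∈ A₂.hyperplanes, H = V₁ ⊔ H₂.map V₂.subtype}

/-- `A` is irreducible: it is not a nontrivial product. -/
def IsIrreducible (A : HyperplaneArrangement K V) : Prop := ¬ A.IsReducible

/-- Lattice equivalence: the intersection lattices are isomorphic. -/
def LatticeEquivalent {W : Type*} [AddCommGroup W] [Module K W]
    (A : HyperplaneArrangement K V) (B : HyperplaneArrangement K W) : Prop :=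
  Nonempty (A.IntersectionLattice ≃o B.IntersectionLattice)

theorem finrank_quotient_ker_eq_one (α : Module.Dual K V) (hα : α ≠ 0) :
    Module.finrank K (V ⧸ LinearMap.ker α) = 1 := by
  rw [(α.quotKerEquivOfSurjective (LinearMap.surjective hα)).finrank_eq, Module.finrank_self]

/-- The arrangement `{ker (α i) | i}` defined by a finite family of nonzero linear forms. -/
def ofForms {ι : Type*} [Finite ι] (α : ι → Module.Dual K V) (hα : ∀ i, α i ≠ 0) :
    HyperplaneArrangement K V where
  hyperplanes := Set.range fun i => LinearMap.ker (α i)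
  finite := Set.finite_range _
  codim_one := by
    rintro _ ⟨i, rfl⟩
    exact finrank_quotient_ker_eq_one (α i) (hα i)

end Field

section Real

variable {V : Type*} [AddCommGroup V] [Module ℝ V]

/-- The complement `V \ ⋃_{H ∈ A} H`. -/
def complement (A : HyperplaneArrangement ℝ V) : Set V := {v | ∀ H ∈ A.hyperplanes, v ∉ H}

/-- The chambers of `A`: the connected components of the complement. -/
def chambers [TopologicalSpace V] (A : HyperplaneArrangement ℝ V) : Set (Set V) :=
  {C | ∃ x ∈ A.complement, C = connectedComponentIn A.complement x}

/-- An open simplicial cone: all linear combinations with positive coefficients of some basis. -/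
def IsOpenSimplicialCone (C : Set V) : Prop :=
  ∃ b : Module.Basis (Fin (Module.finrank ℝ V)) ℝ V, C = {v | ∀ i, 0 < b.repr v i}

/-- `A` is simplicial: every chamber is an open simplicial cone. -/
def IsSimplicial [TopologicalSpace V] (A : HyperplaneArrangement ℝ V) : Prop :=
  ∀ C ∈ A.chambers, IsOpenSimplicialCone C

end Real

/-- The normal vectors of `A(2n,1)`: with `c(m) = cos (2πm / 2n)` and `s(m) = sin (2πm / 2n)`,
the vectors `(-s(k), c(k), 0)` and `(c(2k+1), s(2k+1), 1)` for `0 ≤ k < n`. -/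
noncomputable def normalsA2n1 (n : ℕ) : Fin n ⊕ Fin n → (Fin 3 → ℝ)
  | Sum.inl k => ![-Real.sin (2 * Real.pi * (k : ℕ) / (2 * n)),
      Real.cos (2 * Real.pi * (k : ℕ) / (2 * n)), 0]
  | Sum.inr k => ![Real.cos (2 * Real.pi * (2 * (k : ℕ) + 1) / (2 * n)),
      Real.sin (2 * Real.pi * (2 * (k : ℕ) + 1) / (2 * n)), 1]

theorem normalsA2n1_ne_zero (n : ℕ) (i : Fin n ⊕ Fin n) : normalsA2n1 n i ≠ 0 := by
  intro h
  cases i with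
  | inl k =>
    have h0 := congrFun h 0
    have h1 := congrFun h 1
    simp only [normalsA2n1, Matrix.cons_val_zero, Matrix.cons_val_one, Pi.zero_apply,
      neg_eq_zero] at h0 h1
    have := Real.sin_sq_add_cos_sq (2 * Real.pi * (k : ℕ) / (2 * n))
    rw [h0, h1] at this
    norm_num at this
  | inr k =>
    have h2 := congrFun h 2
    simp [normalsA2n1] at h2

/-- The linear form `x ↦ v₀ x₀ + v₁ x₁ + v₂ x₂` on `ℝ³`. -/
def formOfNormal (v : Fin 3 → ℝ) : Module.Dual ℝ (Fin 3 → ℝ) where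
  toFun x := v ⬝ᵥ x
  map_add' := dotProduct_add v
  map_smul' c x := dotProduct_smul c v x

theorem formOfNormal_ne_zero (v : Fin 3 → ℝ) (hv : v ≠ 0) : formOfNormal v ≠ 0 := by
  intro h
  exact hv (dotProduct_self_eq_zero.mp (LinearMap.congr_fun h v))

/-- The simplicial arrangement `A(2n,1)` in `ℝ³` (meaningful for `n ≥ 3`). -/
noncomputable def A2n1 (n : ℕ) : HyperplaneArrangement ℝ (Fin 3 → ℝ) :=
  ofForms (fun i => formOfNormal (normalsA2n1 n i))
    fun i => formOfNormal_ne_zero _ (normalsA2n1_ne_zero n i)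

end HyperplaneArrangement

/-! Choose coordinates with `X` as the third axis. The `n` hyperplanes through `X` become walls at
angles `θ k`, cutting the circle of directions into `2n` sectors; every other hyperplane `p₁x + p₂y
+ z = 0` becomes a sinusoid `p₁ cos ψ + p₂ sin ψ`. Modularity of `X` says that two sinusoids cross
only at walls (`exists_sinusoid_eq`). Simpliciality says that neighbouring sinusoids over a sector
meet at an end of it, since otherwise a chamber contains a cone with four facets
(`sinusoid_eq_of_adjacent`, `IsSimplicial.card_le_finrank`).

The rest is combinatorics of the upper envelope. The largest function stays the same for exactly two
consecutive sectors (`not_isTop_three`, `isTop_three`), so one turn yields `n` functions `S j`, with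
`S j` on top in sectors `2j` and `2j+1` after renumbering. For fixed `i`, the wall where `S j`
overtakes `S i` increases strictly with `j`, and it has only `n - 1` possible values for the `n - 1`
indices `j`; hence it is `i + j + 1` (`wall_eq_iff`). These are the incidences between the sides and
symmetry axes of a regular `n`-gon. They determine all dependent triples of normals, hence all
linear dependencies, hence the intersection lattice (`latticeEquivalent_of_hasPolygonIncidences`).

Irreducibility supplies two sinusoids to compare and excludes `n = 2`, where one vector would lie in
all hyperplanes but one. -/

open Real

namespace HyperplaneArrangement

/-! ### Intersection lattices from linear dependencies of forms -/

section LatticeEquivalence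

variable {K V W ι : Type*} [Field K] [AddCommGroup V] [Module K V] [AddCommGroup W] [Module K W]
  [Finite ι]

theorem iInf_mem_flats_ofForms (α : ι → Module.Dual K V) (hα : ∀ i, α i ≠ 0) (T : Set ι) :
    ⨅ i ∈ T, LinearMap.ker (α i) ∈ (ofForms α hα).flats :=
  ⟨(fun i => LinearMap.ker (α i)) '' T, Set.image_subset_range _ _, by rw [sInf_image]⟩

theorem eq_iInf_of_mem_flats_ofForms (α : ι → Module.Dual K V) (hα : ∀ i, α i ≠ 0)
    {X : Submodule K V} (hX : X ∈ (ofForms α hα).flats) :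
    ⨅ i ∈ {i | X ≤ LinearMap.ker (α i)}, LinearMap.ker (α i) = X := by
  obtain ⟨S, hS, rfl⟩ := hX
  refine le_antisymm (le_sInf fun H hH => ?_) (le_iInf₂ fun i hi => hi)
  obtain ⟨i, rfl⟩ := hS hH
  have hi : i ∈ {i | sInf S ≤ LinearMap.ker (α i)} := sInf_le hH
  exact iInf₂_le (f := fun i (_ : i ∈ {i | sInf S ≤ LinearMap.ker (α i)}) =>
    LinearMap.ker (α i)) i hi

/-- Two families of forms with the same dependencies define lattice-equivalent arrangements. -/
theorem latticeEquivalent_ofForms (α : ι → Module.Dual K V) (hα : ∀ i, α i ≠ 0)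
    (β : ι → Module.Dual K W) (hβ : ∀ i, β i ≠ 0)
    (h : ∀ (T : Set ι) (j : ι), ⨅ i ∈ T, LinearMap.ker (α i) ≤ LinearMap.ker (α j) ↔
      ⨅ i ∈ T, LinearMap.ker (β i) ≤ LinearMap.ker (β j)) :
    (ofForms α hα).LatticeEquivalent (ofForms β hβ) := by
  have key : ∀ X ∈ (ofForms α hα).flats, ∀ j,
      ⨅ i ∈ {i | X ≤ LinearMap.ker (α i)}, LinearMap.ker (β i) ≤ LinearMap.ker (β j) ↔
        X ≤ LinearMap.ker (α j) := fun X hX j => by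
    rw [← h, eq_iInf_of_mem_flats_ofForms α hα hX]
  have key' : ∀ Y ∈ (ofForms β hβ).flats, ∀ j,
      ⨅ i ∈ {i | Y ≤ LinearMap.ker (β i)}, LinearMap.ker (α i) ≤ LinearMap.ker (α j) ↔
        Y ≤ LinearMap.ker (β j) := fun Y hY j => by
    rw [h, eq_iInf_of_mem_flats_ofForms β hβ hY]
  let e : (ofForms α hα).flats ≃o (ofForms β hβ).flats :=
    { toFun := fun X => ⟨_, iInf_mem_flats_ofForms β hβ {i | X.1 ≤ LinearMap.ker (α i)}⟩
      invFun := fun Y => ⟨_, iInf_mem_flats_ofForms α hα {i | Y.1 ≤ LinearMap.ker (β i)}⟩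
      left_inv := fun X => Subtype.ext <| by
        simp only [key X.1 X.2]
        exact eq_iInf_of_mem_flats_ofForms α hα X.2
      right_inv := fun Y => Subtype.ext <| by
        simp only [key' Y.1 Y.2]
        exact eq_iInf_of_mem_flats_ofForms β hβ Y.2
      map_rel_iff' := fun {X X'} => by
        change (⨅ i ∈ {i | X.1 ≤ LinearMap.ker (α i)}, LinearMap.ker (β i)) ≤
          (⨅ i ∈ {i | X'.1 ≤ LinearMap.ker (α i)}, LinearMap.ker (β i)) ↔ X.1 ≤ X'.1
        constructor
        · intro hle
          rw [← eq_iInf_of_mem_flats_ofForms α hα X'.2]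
          refine le_iInf₂ fun i hi => (key X.1 X.2 i).1 (hle.trans (iInf₂_le i hi))
        · intro hle
          exact le_iInf₂ fun i hi => iInf₂_le i (hle.trans hi) }
  exact ⟨e.dual⟩

/-- By duality, a form vanishing on the common kernel of finitely many forms is a combination of
them. This turns the criterion of `latticeEquivalent_ofForms` into a statement about spans of
normals. -/
theorem iInf_ker_le_ker_iff_mem_span (α : ι → Module.Dual K V) (T : Set ι) (j : ι) :
    ⨅ i ∈ T, LinearMap.ker (α i) ≤ LinearMap.ker (α j) ↔
      α j ∈ Submodule.span K (α '' T) := by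
  constructor
  · intro h
    have : ⨅ i : T, LinearMap.ker (α i) ≤ LinearMap.ker (α j) := by rwa [iInf_subtype]
    have := mem_span_of_iInf_ker_le_ker this
    rwa [Set.image_eq_range]
  · intro h v hv
    simp only [Submodule.mem_iInf, LinearMap.mem_ker] at hv ⊢
    generalize α j = γ at h
    induction h using Submodule.span_induction with
    | mem x hx => obtain ⟨i, hi, rfl⟩ := hx; exact hv i hi
    | zero => rfl
    | add x y _ _ hx hy => simp [hx, hy]
    | smul c x _ hx => simp [hx]

end LatticeEquivalence

/-! ### Dependencies in three-space from vanishing determinants -/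

section Matroid

variable {K ι : Type*} [Field K]

theorem mem_span_pair_iff_det_eq_zero {x y : Fin 3 → K} (hxy : LinearIndependent K ![x, y])
    (z : Fin 3 → K) :
    z ∈ Submodule.span K {x, y} ↔ (Matrix.of ![x, y, z]).det = 0 := by
  have h1 : LinearIndependent K (Matrix.of ![x, y, z]).row ↔ z ∉ Submodule.span K {x, y} := by
    have : (Matrix.of ![x, y, z]).row = Fin.snoc ![x, y] z := by
      funext i; fin_cases i <;> rfl
    rw [this, linearIndependent_finSnoc]
    simp [hxy, Matrix.range_cons]
    rw [Set.pair_comm]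
  rw [Matrix.linearIndependent_rows_iff_isUnit, Matrix.isUnit_iff_isUnit_det, isUnit_iff_ne_zero]
    at h1
  tauto

/-- In `K³` the dependencies of a family of pairwise independent vectors are determined by the
triples with vanishing determinant. -/
theorem mem_span_image_of_det_eq_zero_iff {v w : ι → Fin 3 → K}
    (hv : ∀ i j, i ≠ j → LinearIndependent K ![v i, v j]) (hv0 : ∀ i, v i ≠ 0)
    (hw : ∀ i j, i ≠ j → LinearIndependent K ![w i, w j])
    (h : ∀ i j k, (Matrix.of ![v i, v j, v k]).det = 0 ↔ (Matrix.of ![w i, w j, w k]).det = 0)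
    (T : Set ι) (m : ι) (hm : v m ∈ Submodule.span K (v '' T)) :
    w m ∈ Submodule.span K (w '' T) := by
  -- The cases are the rank of `v '' T`: three, two, or at most one. Pairwise independence makes any
  -- two distinct indices a basis in the rank two case.
  by_cases h3 : ∃ i ∈ T, ∃ j ∈ T, ∃ k ∈ T, (Matrix.of ![v i, v j, v k]).det ≠ 0
  · obtain ⟨i, hi, j, hj, k, hk, hd⟩ := h3
    rw [Ne, h, ← Ne, ← isUnit_iff_ne_zero, ← Matrix.isUnit_iff_isUnit_det,
      ← Matrix.linearIndependent_rows_iff_isUnit] at hd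
    have htop := hd.span_eq_top_of_card_eq_finrank (by simp)
    have : Submodule.span K (Set.range (Matrix.of ![w i, w j, w k]).row) ≤
        Submodule.span K (w '' T) := by
      refine Submodule.span_mono ?_
      rintro _ ⟨a, rfl⟩
      fin_cases a
      exacts [⟨i, hi, rfl⟩, ⟨j, hj, rfl⟩, ⟨k, hk, rfl⟩]
    rw [htop] at this
    exact this trivial
  push Not at h3
  by_cases h2 : ∃ i ∈ T, ∃ j ∈ T, i ≠ j
  · obtain ⟨i, hi, j, hj, hij⟩ := h2
    have hle : Submodule.span K (v '' T) ≤ Submodule.span K {v i, v j} := by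
      rw [Submodule.span_le]
      rintro _ ⟨k, hk, rfl⟩
      exact (mem_span_pair_iff_det_eq_zero (hv i j hij) _).2 (h3 i hi j hj k hk)
    have := (mem_span_pair_iff_det_eq_zero (hw i j hij) _).2
      ((h i j m).1 ((mem_span_pair_iff_det_eq_zero (hv i j hij) _).1 (hle hm)))
    refine Submodule.span_mono ?_ this
    rintro _ (rfl | rfl)
    exacts [⟨i, hi, rfl⟩, ⟨j, hj, rfl⟩]
  push Not at h2
  by_cases hmT : m ∈ T
  · exact Submodule.subset_span ⟨m, hmT, rfl⟩
  exfalso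
  rcases T.eq_empty_or_nonempty with rfl | ⟨i, hi⟩
  · simp [hv0] at hm
  · have hT : T = {i} := by
      ext j; exact ⟨fun hj => h2 j hj i hi, fun hj => hj ▸ hi⟩
    subst hT
    rw [Set.image_singleton, Submodule.mem_span_singleton] at hm
    obtain ⟨c, hc⟩ := hm
    have := LinearIndependent.pair_iff.1 (hv i m (by rintro rfl; exact hmT rfl)) c (-1)
      (by simp [hc])
    simp at this

end Matroid

end HyperplaneArrangement

/-! ### Combinatorics of the upper envelope -/

/-- Functions on a circle of `2 n` sectors, separated by `2 n` walls: `mid s k` is the value of `s`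
inside the `k`-th sector, between the walls `k` and `k + 1`, and `wall s k` is the value at the
`k`-th wall. Any two of them cross exactly once in each half turn, and only at walls, and two
functions that are neighbours in a sector agree at one of its ends. -/
structure SectorSystem (σ : Type*) (n : ℤ) where
  mid : σ → ℤ → ℝ
  wall : σ → ℤ → ℝ
  antiperiodic : ∀ s, Function.Antiperiodic (mid s) n
  crossing : ∀ s t, s ≠ t → ∃ c, (∀ k, c ≤ k → k < c + n → mid t k < mid s k) ∧
    ∀ k, wall s k = wall t k ↔ n ∣ k - c
  adjacent : ∀ k s t, mid t k < mid s k → (∀ r, ¬(mid t k < mid r k ∧ mid r k < mid s k)) →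
    wall s k = wall t k ∨ wall s (k + 1) = wall t (k + 1)

namespace SectorSystem

variable {σ : Type*} {n : ℤ} (D : SectorSystem σ n)

/-- Renumbering of the sectors. -/
def shift (ε : ℤ) : SectorSystem σ n where
  mid s k := D.mid s (k + ε)
  wall s k := D.wall s (k + ε)
  antiperiodic s k := by
    have := D.antiperiodic s (k + ε)
    rw [← this]; ring_nf
  crossing s t hst := by
    obtain ⟨c, h1, h2⟩ := D.crossing s t hst
    refine ⟨c - ε, fun k hk hk' => h1 _ (by omega) (by omega), fun k => ?_⟩
    rw [h2]; congr! 1; ring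
  adjacent k s t h h' := by
    have := D.adjacent (k + ε) s t h h'
    rwa [show k + 1 + ε = k + ε + 1 by ring]

theorem mid_add_two_mul (s : σ) (k m : ℤ) : D.mid s (k + 2 * n * m) = D.mid s k := by
  have := ((D.antiperiodic s).periodic_two_mul.int_mul m) k
  rw [← this]; congr 1; push_cast; ring

/-- Antiperiodicity makes the sign of the difference alternate between successive half turns, so the
half turn given by `crossing` can be translated to the one containing `k`. -/
theorem exists_window (hn : 0 < n) {s t : σ} {k : ℤ} (h : D.mid t k < D.mid s k) :
    ∃ c, c ≤ k ∧ k < c + n ∧ (∀ j, c ≤ j → j < c + n → D.mid t j < D.mid s j) ∧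
      (∀ j, c - n ≤ j → j < c → D.mid s j < D.mid t j) ∧
      (∀ j, c + n ≤ j → j < c + 2 * n → D.mid s j < D.mid t j) ∧
      ∀ j, D.wall s j = D.wall t j ↔ n ∣ j - c := by
  have hst : s ≠ t := by rintro rfl; exact lt_irrefl _ h
  obtain ⟨c₀, h1, h2⟩ := D.crossing s t hst
  have e1 := Int.emod_add_mul_ediv (k - c₀) n
  have e2 := Int.emod_nonneg (k - c₀) hn.ne'
  have e3 := Int.emod_lt_of_pos (k - c₀) hn
  set q := (k - c₀) / n
  have hanti : ∀ r j, D.mid r j = - D.mid r (j - n) := fun r j => by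
    rw [← D.antiperiodic r]; congr 1; ring
  have main : ∀ j, c₀ + n * q ≤ j → j < c₀ + n * q + n → D.mid t j < D.mid s j := by
    -- An odd `q` would place `k` in a half turn where `t` is the larger function.
    rcases Int.even_or_odd' q with ⟨m, hm | hm⟩
    · intro j hj hj'
      have hq : n * q = 2 * n * m := by rw [hm]; ring
      have := h1 (j - 2 * n * m) (by omega) (by omega)
      rwa [← D.mid_add_two_mul t _ m, ← D.mid_add_two_mul s _ m, sub_add_cancel] at this
    · exfalso
      have hq : n * q = 2 * n * m + n := by rw [hm]; ring
      have := h1 (k - n - 2 * n * m) (by omega) (by omega)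
      rw [← D.mid_add_two_mul t _ m, ← D.mid_add_two_mul s _ m, sub_add_cancel] at this
      rw [hanti t k, hanti s k] at h
      linarith
  refine ⟨c₀ + n * q, by omega, by omega, main, fun j hj hj' => ?_, fun j hj hj' => ?_,
    fun j => ?_⟩
  · have := main (j + n) (by omega) (by omega)
    rw [D.antiperiodic, D.antiperiodic] at this
    linarith
  · have := main (j - n) (by omega) (by omega)
    rw [hanti t, hanti s]
    linarith
  · rw [h2, show j - c₀ = j - (c₀ + n * q) + n * q by ring]
    exact (Int.dvd_add_left (dvd_mul_right n q))

theorem mid_ne (hn : 0 < n) {s t : σ} (hst : s ≠ t) (k : ℤ) : D.mid s k ≠ D.mid t k := by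
  intro he
  obtain ⟨c, h1, -⟩ := D.crossing s t hst
  have h2 := h1 c le_rfl (by omega)
  obtain ⟨c', w1, w2, w3, w4, w5, -⟩ := D.exists_window hn h2
  have e1 := Int.emod_add_mul_ediv (k - c') (2 * n)
  have e2 := Int.emod_nonneg (k - c') (by omega : 2 * n ≠ 0)
  have e3 := Int.emod_lt_of_pos (k - c') (by omega : 0 < 2 * n)
  set q := (k - c') / (2 * n)
  have hk : k = (c' + (k - c') % (2 * n)) + 2 * n * q := by omega
  rw [hk, D.mid_add_two_mul, D.mid_add_two_mul] at he
  rcases lt_or_ge (c' + (k - c') % (2 * n)) (c' + n) with h | h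
  · exact (w3 _ (by omega) h).ne' he
  · exact (w5 _ h (by omega)).ne he

/-- `s` is the largest function in the sector `k`. -/
def IsTop (k : ℤ) (s : σ) : Prop := ∀ t, t ≠ s → D.mid t k < D.mid s k

theorem exists_isTop [Finite σ] [Nonempty σ] (hn : 0 < n) (k : ℤ) : ∃ s, D.IsTop k s := by
  obtain ⟨s, hs⟩ := Finite.exists_max fun s => D.mid s k
  exact ⟨s, fun t hts => lt_of_le_of_ne (hs t) (D.mid_ne hn hts k)⟩

variable {D}

/-- The second largest function in the middle sector meets `s` at one end of that sector. It crosses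
`s` there, so it is above `s` in the sector beyond. -/
theorem not_isTop_three [Finite σ] [Nontrivial σ] (hn : 0 < n) {k : ℤ} {s : σ}
    (h0 : D.IsTop (k - 1) s) (h1 : D.IsTop k s) (h2 : D.IsTop (k + 1) s) : False := by
  obtain ⟨t₀, ht₀⟩ := exists_ne s
  have : Nonempty {t // t ≠ s} := ⟨⟨t₀, ht₀⟩⟩
  obtain ⟨⟨t, hts⟩, ht⟩ := Finite.exists_max fun t : {t // t ≠ s} => D.mid t.1 k
  obtain ⟨c, w1, w2, w3, w4, w5, w6⟩ := D.exists_window hn (h1 t hts)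
  have hadj := D.adjacent k s t (h1 t hts) (by
    rintro r ⟨hr1, hr2⟩
    have hrs : r ≠ s := by rintro rfl; exact lt_irrefl _ hr2
    exact (ht ⟨r, hrs⟩).not_gt hr1)
  rw [w6, w6] at hadj
  rcases hadj with hd | hd
  · have := Int.eq_zero_of_dvd_of_nonneg_of_lt (by omega) (by omega) hd
    exact lt_asymm (h0 t hts) (w4 _ (by omega) (by omega))
  · rcases lt_or_ge (k + 1) (c + n) with h | h
    · have := Int.eq_zero_of_dvd_of_nonneg_of_lt (by omega) (by omega) hd
      omega
    · exact lt_asymm (h2 t hts) (w5 _ (by omega) (by omega))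

/-- If both changes occur, `r` and `s` cross at wall `k`, and `s` and `t` at wall `k + 1`. The
crossing of `r` and `t` must be at one of these walls, so `s` meets one of the others at two
consecutive walls, which `n ≥ 2` forbids. -/
theorem isTop_three (hn : 2 ≤ n) {k : ℤ} {r s t : σ}
    (h0 : D.IsTop (k - 1) r) (h1 : D.IsTop k s) (h2 : D.IsTop (k + 1) t) : r = s ∨ s = t := by
  by_contra! hne
  obtain ⟨hrs, hst⟩ := hne
  have hn0 : 0 < n := by omega
  obtain ⟨c, w1, w2, w3, w4, w5, w6⟩ := D.exists_window hn0 (h1 r hrs)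
  obtain ⟨c', w1', w2', w3', w4', w5', w6'⟩ := D.exists_window hn0 (h1 t hst.symm)
  have hc : c = k := by
    by_contra hc
    exact lt_asymm (h0 s hrs.symm) (w3 _ (by omega) (by omega))
  have hc' : c' + n = k + 1 := by
    by_contra hc
    exact lt_asymm (h2 s hst) (w3' _ (by omega) (by omega))
  have hrt : r ≠ t := by
    rintro rfl
    exact lt_asymm (h0 s hst) (w3' _ (by omega) (by omega))
  obtain ⟨d, v1, v2, v3, v4, v5, v6⟩ := D.exists_window hn0 (h0 t hrt.symm)
  have hd : ¬ k + 1 < d + n := fun hd => lt_asymm (h2 r hrt) (v3 _ (by omega) hd)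
  have hone : ¬ n ∣ 1 := fun hd => by
    have := Int.le_of_dvd one_pos hd
    omega
  have z1 : D.wall s k = D.wall r k := (w6 k).2 (by simp [hc])
  have z2 : D.wall s (k + 1) = D.wall t (k + 1) := (w6' _).2 ⟨1, by omega⟩
  rcases (by omega : d + n = k ∨ d + n = k + 1) with hd | hd
  · have z3 : D.wall r k = D.wall t k := (v6 k).2 ⟨1, by omega⟩
    have := (w6' k).1 (z1.trans z3)
    rw [show k - c' = n - 1 by omega] at this
    exact hone ((dvd_sub_right (dvd_refl n)).1 this)
  · have z3 : D.wall r (k + 1) = D.wall t (k + 1) := (v6 _).2 ⟨1, by omega⟩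
    have := (w6 (k + 1)).1 (z2.trans z3.symm)
    rw [show k + 1 - c = 1 by omega] at this
    exact hone this

/-- The window of two functions `S i`, `S j` which are on top in the sectors `2 i`, `2 i + 1` and
`2 j`, `2 j + 1`, respectively. -/
theorem exists_window_of_isTop (hn : 2 ≤ n) {S : ℤ → σ} (h0 : ∀ j, D.IsTop (2 * j) (S j))
    (h1 : ∀ j, D.IsTop (2 * j + 1) (S j)) (hS : ∀ j, S j ≠ S (j + 1))
    {i j : ℤ} (hij : i < j) (hj : j < i + n) :
    ∃ c, 2 * i + 2 ≤ c ∧ c ≤ 2 * j ∧ 2 * j + 2 ≤ c + n ∧ c - n ≤ 2 * i ∧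
      (∀ k, c ≤ k → k < c + n → D.mid (S i) k < D.mid (S j) k) ∧
      (∀ k, c - n ≤ k → k < c → D.mid (S j) k < D.mid (S i) k) ∧
      ∀ k, D.wall (S i) k = D.wall (S j) k ↔ n ∣ k - c := by
  have hn0 : 0 < n := by omega
  -- The neighbours `S (i + 1)` and `S (i - 1)` between them exceed `S i` in all sectors from `2i +
  -- 2` to `2i + 2n - 1`, and `2j` is one of these.
  have hne : S j ≠ S i := by
    intro he
    have ht := hS i
    obtain ⟨c, w1, w2, w3, w4, w5, w6⟩ := D.exists_window hn0 (h1 i _ ht.symm)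
    have hc : c + n = 2 * i + 2 := by
      by_contra hc
      have := h0 (i + 1) _ ht
      rw [show 2 * (i + 1) = 2 * i + 1 + 1 by ring] at this
      exact lt_asymm this (w3 _ (by omega) (by omega))
    have ht' : S (i - 1) ≠ S i := by simpa using hS (i - 1)
    obtain ⟨d, v1, v2, v3, v4, v5, v6⟩ := D.exists_window hn0 (h0 i _ ht')
    have hd : d = 2 * i := by
      by_contra hd
      have := h1 (i - 1) _ ht'.symm
      exact lt_asymm this (v3 _ (by omega) (by omega))
    have hj0 := h0 j
    rw [he] at hj0
    rcases lt_or_ge (2 * j) (2 * i + 2 + n) with h | h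
    · exact lt_asymm (hj0 _ ht.symm) (w5 _ (by omega) (by omega))
    · exact lt_asymm (hj0 _ ht') (v5 _ (by omega) (by omega))
  obtain ⟨c, w1, w2, w3, w4, w5, w6⟩ := D.exists_window hn0 (h0 j _ hne.symm)
  have hi0 := h0 i _ hne
  have hj1 := h1 j _ hne.symm
  have a1 : 2 * i < c := by
    by_contra hc
    exact lt_asymm hi0 (w3 _ (by omega) (by omega))
  have a2 : 2 * j + 1 < c + n := by
    by_contra hc
    exact lt_asymm hj1 (w5 _ (by omega) (by omega))
  have a3 : 2 * i + 1 ≠ c := fun hc =>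
    lt_asymm (h1 i _ hne) (w3 _ (by omega) (by omega))
  refine ⟨c, by omega, w1, by omega, ?_, w3, w4, fun k => ?_⟩
  · by_contra hc
    -- Otherwise the window would reach sector `2i + 2n`, which is sector `2i` one turn later, where
    -- `S i` is on top.
    have := w3 (2 * i + 2 * n) (by omega) (by omega)
    rw [← mul_one (2 * n), D.mid_add_two_mul, D.mid_add_two_mul] at this
    exact lt_asymm hi0 this
  · rw [eq_comm, w6]

/-- With `c i j` the wall where `S j` overtakes `S i`, the values `c i (i+1) < ⋯ < c i (i+n-1)` are
`n - 1` integers in `[2i + 2, 2i + n]`, which leaves no choice. -/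
theorem wall_eq_iff (hn : 2 ≤ n) {S : ℤ → σ} (h0 : ∀ j, D.IsTop (2 * j) (S j))
    (h1 : ∀ j, D.IsTop (2 * j + 1) (S j)) (hS : ∀ j, S j ≠ S (j + 1))
    {i j : ℤ} (hij : i < j) (hj : j < i + n) (k : ℤ) :
    D.wall (S i) k = D.wall (S j) k ↔ n ∣ k - (i + j + 1) := by
  choose! c c1 c2 c3 c4 c5 c6 c7 using
    fun (i j : ℤ) (h : i < j ∧ j < i + n) => exists_window_of_isTop hn h0 h1 hS h.1 h.2
  -- If `S l` overtook `S i` before `S j` did, then `S j < S i < S l < S j` in sector `c i l`. If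
  -- both did at the same wall, `S j` and `S l` would also meet there, too close to their own
  -- crossing `c j l`.
  have hmono : ∀ i j l, i < j → j < l → l < i + n → c i j < c i l := by
    intro i j l hij hjl hl
    have Hij : i < j ∧ j < i + n := ⟨hij, by omega⟩
    have Hil : i < l ∧ l < i + n := ⟨by omega, hl⟩
    have Hjl : j < l ∧ l < j + n := ⟨hjl, by omega⟩
    by_contra! hle
    have b1 := c1 _ _ Hij; have b2 := c2 _ _ Hij; have b3 := c3 _ _ Hij; have b4 := c4 _ _ Hij
    have b1' := c1 _ _ Hil; have b2' := c2 _ _ Hil; have b3' := c3 _ _ Hil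
    have b4' := c4 _ _ Hil
    have d1 := c1 _ _ Hjl; have d2 := c2 _ _ Hjl; have d3 := c3 _ _ Hjl; have d4 := c4 _ _ Hjl
    rcases hle.lt_or_eq with hlt | heq
    · have := c5 _ _ Hil (c i l) le_rfl (by omega)
      have := c6 _ _ Hij (c i l) (by omega) hlt
      have := c6 _ _ Hjl (c i l) (by omega) (by omega)
      linarith
    · have z1 := (c7 _ _ Hij (c i j)).2 (by simp)
      have z2 := (c7 _ _ Hil (c i j)).2 (by simp [heq])
      have z3 := (dvd_sub_comm).1 ((c7 _ _ Hjl (c i j)).1 (z1.symm.trans z2))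
      have := Int.eq_zero_of_dvd_of_nonneg_of_lt (by omega) (by omega) z3
      omega
  -- Strict growth gives a lower bound counted up from `j = i + 1` and an upper bound counted down
  -- from `j = i + n - 1`; the two coincide.
  have hlow : ∀ m : ℕ, i + 1 + m < i + n → 2 * i + 2 + m ≤ c i (i + 1 + m) := by
    intro m
    induction m with
    | zero =>
      intro h
      have := c1 i (i + 1) ⟨by omega, by simpa using h⟩
      simpa using this
    | succ m ih =>
      intro h
      push_cast at h ⊢
      have := ih (by omega)
      have := hmono i (i + 1 + m) (i + 1 + (m + 1)) (by omega) (by omega) h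
      omega
  have hup : ∀ m : ℕ, i < i + n - 1 - m → c i (i + n - 1 - m) ≤ 2 * i + n - m := by
    intro m
    induction m with
    | zero =>
      intro h
      have := c4 i (i + n - 1) ⟨by simpa using h, by omega⟩
      simp; omega
    | succ m ih =>
      intro h
      push_cast at h ⊢
      have := ih (by omega)
      have := hmono i (i + n - 1 - (m + 1)) (i + n - 1 - m) h (by omega) (by omega)
      omega
  have hc : c i j = i + j + 1 := by
    obtain ⟨m, hm⟩ := Int.eq_ofNat_of_zero_le (by omega : 0 ≤ j - i - 1)
    obtain ⟨m', hm'⟩ := Int.eq_ofNat_of_zero_le (by omega : 0 ≤ i + n - 1 - j)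
    have := hlow m (by omega)
    have := hup m' (by omega)
    rw [show i + 1 + (m : ℤ) = j by omega] at *
    rw [show i + n - 1 - (m' : ℤ) = j by omega] at *
    omega
  rw [c7 i j ⟨hij, hj⟩, hc]

/-- The functions that are on top in some sector, in their cyclic order. -/
theorem exists_top_sequence [Finite σ] [Nontrivial σ] (hn : 2 ≤ n) (D : SectorSystem σ n) :
    ∃ (ε : ℤ) (S : ℤ → σ),
      (∀ i j, i < j → j < i + n → S i ≠ S j) ∧
      (∀ i j k, i < j → j < i + n →
        (D.wall (S i) (k + ε) = D.wall (S j) (k + ε) ↔ n ∣ k - (i + j + 1))) ∧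
      (n = 2 → ∀ t, D.wall (S 0) ε = D.wall t ε) := by
  have hn0 : 0 < n := by omega
  choose L hL using D.exists_isTop hn0
  have hA : ∀ k, L (k - 1) = L k → L k ≠ L (k + 1) := by
    intro k h h'
    refine not_isTop_three hn0 (k := k) (h ▸ hL (k - 1)) (hL k) (h' ▸ hL (k + 1))
  have hB : ∀ k, L (k - 1) ≠ L k → L k = L (k + 1) := fun k h =>
    (isTop_three hn (hL (k - 1)) (hL k) (hL (k + 1))).resolve_left h
  -- Equality and change of the top function alternate; `ε` is chosen so that the equal pairs begin
  -- at even sectors.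
  have hstep : ∀ k, L (k - 1) = L k ↔ L (k + 1) = L (k + 1 + 1) := by
    intro k
    have h1 := hA k; have h2 := hB k
    have h3 := hA (k + 1); have h4 := hB (k + 1)
    rw [add_sub_cancel_right] at h3 h4
    tauto
  obtain ⟨ε, hε⟩ : ∃ ε, L ε = L (ε + 1) := by
    by_cases h : L 0 = L 1
    · exact ⟨0, by simpa using h⟩
    · exact ⟨1, by simpa using hB 1 (by simpa using h)⟩
  have hall : ∀ j : ℤ, L (2 * j + ε) = L (2 * j + 1 + ε) := by
    intro j
    induction j using Int.induction_on with
    | zero => simpa [add_comm] using hε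
    | succ j ih =>
      have := (hstep (2 * j + 1 + ε)).1 (by rw [← ih]; congr 1; ring)
      convert this using 2 <;> ring
    | pred j ih =>
      have := (hstep (2 * (-j - 1) + 1 + ε)).2
        (by convert ih using 2 <;> ring)
      rw [← this]; congr 1; ring
  have h0 : ∀ j, (D.shift ε).IsTop (2 * j) (L (2 * j + ε)) := fun j => hL (2 * j + ε)
  have h1 : ∀ j, (D.shift ε).IsTop (2 * j + 1) (L (2 * j + ε)) := fun j => by
    rw [hall]; exact hL (2 * j + 1 + ε)
  have hS : ∀ j : ℤ, L (2 * j + ε) ≠ L (2 * (j + 1) + ε) := fun j => by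
    have := hA (2 * j + 1 + ε) (by rw [← hall]; congr 1; ring)
    rw [← hall] at this
    convert this using 2; ring
  refine ⟨ε, fun j => L (2 * j + ε), fun i j hij hj he => ?_,
    fun i j k hij hj => wall_eq_iff (D := D.shift ε) hn h0 h1 hS hij hj k, fun h2 t => ?_⟩
  · obtain ⟨c, -, b2, b3, -, w, -⟩ := exists_window_of_isTop hn h0 h1 hS hij hj
    have := w c le_rfl (by omega)
    simp only [] at he
    rw [he] at this
    exact lt_irrefl _ this
  -- For `n = 2` the sectors 0 and 1, where `S 0` is on top, fill a whole half turn, so every other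
  -- function crosses `S 0` exactly at its ends.
  · rcases eq_or_ne t (L (2 * 0 + ε)) with rfl | ht
    · rfl
    obtain ⟨c, w1, w2, w3, w4, w5, w6⟩ := (D.shift ε).exists_window hn0 (h0 0 t ht)
    have := h1 0 t ht
    have hc : c = 0 := by
      by_contra hc
      exact lt_asymm this (w5 _ (by omega) (by omega))
    have := (w6 0).2 (by simp [hc])
    simpa [shift] using this

end SectorSystem

/-! ### Sinusoids -/

section Sinusoid

/-- The sinusoid `ψ ↦ p₁ cos ψ + p₂ sin ψ`. -/
noncomputable def sinusoid (p : ℝ × ℝ) (ψ : ℝ) : ℝ := p.1 * cos ψ + p.2 * sin ψ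

theorem sinusoid_sub (p q : ℝ × ℝ) (ψ : ℝ) :
    sinusoid (p - q) ψ = sinusoid p ψ - sinusoid q ψ := by
  simp only [sinusoid, Prod.fst_sub, Prod.snd_sub]; ring

theorem continuous_sinusoid (p : ℝ × ℝ) : Continuous (sinusoid p) := by
  unfold sinusoid; fun_prop

theorem sinusoid_eq (p : ℝ × ℝ) (φ ψ : ℝ) :
    sinusoid p ψ = sinusoid p φ * cos (ψ - φ) + sinusoid p (φ + π / 2) * sin (ψ - φ) := by
  simp only [sinusoid, cos_add_pi_div_two, sin_add_pi_div_two, cos_sub, sin_sub]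
  linear_combination (-(p.1 * cos ψ + p.2 * sin ψ)) * sin_sq_add_cos_sq φ

theorem eq_zero_of_sinusoid_eq_zero {p : ℝ × ℝ} {φ : ℝ} (h : sinusoid p φ = 0)
    (h' : sinusoid p (φ + π / 2) = 0) : p = 0 := by
  have h0 := sinusoid_eq p φ 0
  have h1 := sinusoid_eq p φ (π / 2)
  rw [h, h'] at h0 h1
  ext <;> simp [sinusoid] at h0 h1 ⊢ <;> assumption

theorem sin_int_mul_pi_div_eq_zero_iff {n : ℕ} (hn : n ≠ 0) (m : ℤ) :
    sin (π * m / n) = 0 ↔ (n : ℤ) ∣ m := by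
  have hn' : (n : ℝ) ≠ 0 := by exact_mod_cast hn
  rw [sin_eq_zero_iff]
  constructor
  · rintro ⟨q, hq⟩
    refine ⟨q, ?_⟩
    have : (m : ℝ) = n * q := by
      field_simp at hq
      nlinarith [pi_pos]
    exact_mod_cast this
  · rintro ⟨q, rfl⟩
    refine ⟨q, ?_⟩
    push_cast
    field_simp

end Sinusoid

/-! ### Walls at given angles, and the sector system of a family of sinusoids -/

section Angles

variable {θ : ℤ → ℝ} {n : ℤ}

theorem angle_add_mul (hθ : ∀ k, θ (k + n) = θ k + π) (k m : ℤ) :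
    θ (k + n * m) = θ k + m * π := by
  induction m using Int.induction_on with
  | zero => simp
  | succ m ih =>
    rw [show k + n * ((m : ℤ) + 1) = k + n * m + n by ring, hθ, ih]; push_cast; ring
  | pred m ih =>
    have := hθ (k + n * (-(m : ℤ) - 1))
    rw [show k + n * (-(m : ℤ) - 1) + n = k + n * -(m : ℤ) by ring, ih] at this
    push_cast at this ⊢; linarith

theorem exists_angle_eq (hθ : ∀ k, θ (k + n) = θ k + π) {ψ : ℝ} {j : ℤ}
    (h : sin (ψ - θ j) = 0) : ∃ m, ψ = θ (j + n * m) := by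
  obtain ⟨m, hm⟩ := sin_eq_zero_iff.1 h
  exact ⟨m, by rw [angle_add_mul hθ]; linarith⟩

theorem sin_angle_sub_eq_zero_iff (hmono : StrictMono θ) (hθ : ∀ k, θ (k + n) = θ k + π)
    (k j : ℤ) : sin (θ k - θ j) = 0 ↔ n ∣ k - j := by
  constructor
  · intro h
    obtain ⟨m, hm⟩ := exists_angle_eq hθ h
    exact ⟨m, by rw [hmono.injective hm]; ring⟩
  · rintro ⟨m, hm⟩
    rw [show k = j + n * m by omega, angle_add_mul hθ, add_sub_cancel_left, sin_int_mul_pi]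

theorem sin_sub_angle_ne_zero (hmono : StrictMono θ) (hθ : ∀ k, θ (k + n) = θ k + π) {ψ : ℝ}
    {k : ℤ} (h : ψ ∈ Set.Ioo (θ k) (θ (k + 1))) (j : ℤ) : sin (ψ - θ j) ≠ 0 := by
  intro h0
  obtain ⟨m, rfl⟩ := exists_angle_eq hθ h0
  have h1 := hmono.lt_iff_lt.1 h.1
  have h2 := hmono.lt_iff_lt.1 h.2
  omega

/-- A sinusoid vanishing at `θ j` is a multiple of `sin (ψ - θ j)`; a negative amplitude is absorbed
by passing to `θ (j + n) = θ j + π`. -/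
theorem exists_sinusoid_eq_mul_sin (hθ : ∀ k, θ (k + n) = θ k + π) {p : ℝ × ℝ} (hp : p ≠ 0)
    {j : ℤ} (h : sinusoid p (θ j) = 0) :
    ∃ c R, 0 < R ∧ ∀ ψ, sinusoid p ψ = R * sin (ψ - θ c) := by
  have key := sinusoid_eq p (θ j)
  rcases lt_trichotomy (sinusoid p (θ j + π / 2)) 0 with hlt | h0 | hgt
  · refine ⟨j + n, _, neg_pos.2 hlt, fun ψ => ?_⟩
    rw [key, h, hθ, ← sub_sub, sin_sub_pi]; ring
  · exact absurd (eq_zero_of_sinusoid_eq_zero h h0) hp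
  · exact ⟨j, _, hgt, fun ψ => by rw [key, h]; ring⟩

/-- The difference has all its zeros at walls once it has one there, so by the intermediate value
theorem its sign is constant inside a sector. -/
theorem sinusoid_lt_of_mem_Ioo (hmono : StrictMono θ) (hθ : ∀ k, θ (k + n) = θ k + π)
    {p q : ℝ × ℝ} {j : ℤ} (hj : sinusoid p (θ j) = sinusoid q (θ j)) {k : ℤ} {ψ φ : ℝ}
    (hψ : ψ ∈ Set.Ioo (θ k) (θ (k + 1))) (hφ : φ ∈ Set.Ioo (θ k) (θ (k + 1)))
    (h : sinusoid p ψ < sinusoid q ψ) : sinusoid p φ < sinusoid q φ := by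
  rcases eq_or_ne q p with rfl | hne
  · exact absurd h (lt_irrefl _)
  obtain ⟨c, R, hR, hs⟩ := exists_sinusoid_eq_mul_sin hθ (sub_ne_zero.2 hne)
    (j := j) (by rw [sinusoid_sub, hj, sub_self])
  by_contra! hle
  have h1 : 0 < sinusoid (q - p) ψ := by rw [sinusoid_sub]; linarith
  have h2 : sinusoid (q - p) φ ≤ 0 := by rw [sinusoid_sub]; linarith
  obtain ⟨x, hx, hx0⟩ := intermediate_value_uIcc
    (continuous_sinusoid (q - p)).continuousOn (Set.mem_uIcc.2 (Or.inl ⟨h2, h1.le⟩))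
  have hxI : x ∈ Set.Ioo (θ k) (θ (k + 1)) :=
    Set.ordConnected_Ioo.uIcc_subset hφ hψ hx
  rw [hs] at hx0
  exact sin_sub_angle_ne_zero hmono hθ hxI c ((mul_eq_zero.1 hx0).resolve_left hR.ne')

/-- The system of sectors defined by a family of sinusoids that cross only at the angles `θ k`. -/
noncomputable def sectorSystemOfSinusoids {σ : Type*} (hmono : StrictMono θ)
    (hθ : ∀ k, θ (k + n) = θ k + π) (p : σ → ℝ × ℝ) (hp : Function.Injective p)
    (hcross : ∀ s t, s ≠ t → ∃ j, sinusoid (p s) (θ j) = sinusoid (p t) (θ j))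
    (hadj : ∀ k s t, sinusoid (p t) ((θ k + θ (k + 1)) / 2) <
        sinusoid (p s) ((θ k + θ (k + 1)) / 2) →
      (∀ r, ¬(sinusoid (p t) ((θ k + θ (k + 1)) / 2) < sinusoid (p r) ((θ k + θ (k + 1)) / 2) ∧
        sinusoid (p r) ((θ k + θ (k + 1)) / 2) < sinusoid (p s) ((θ k + θ (k + 1)) / 2))) →
      sinusoid (p s) (θ k) = sinusoid (p t) (θ k) ∨
        sinusoid (p s) (θ (k + 1)) = sinusoid (p t) (θ (k + 1))) :
    SectorSystem σ n where
  mid s k := sinusoid (p s) ((θ k + θ (k + 1)) / 2)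
  wall s k := sinusoid (p s) (θ k)
  antiperiodic s k := by
    change sinusoid (p s) ((θ (k + n) + θ (k + n + 1)) / 2) = -sinusoid (p s) _
    rw [add_right_comm k n 1, hθ, hθ,
      show (θ k + π + (θ (k + 1) + π)) / 2 = (θ k + θ (k + 1)) / 2 + π by ring]
    simp only [sinusoid, cos_add_pi, sin_add_pi]; ring
  crossing s t hst := by
    obtain ⟨j, hj⟩ := hcross s t hst
    obtain ⟨c, R, hR, hs⟩ := exists_sinusoid_eq_mul_sin hθ (sub_ne_zero.2 (hp.ne hst))
      (j := j) (by rw [sinusoid_sub, hj, sub_self])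
    refine ⟨c, fun k hk hk' => ?_, fun k => ?_⟩
    · have h1 := hmono.monotone hk
      have h2 := hmono.monotone (by omega : k + 1 ≤ c + n)
      have h3 := hmono (lt_add_one k)
      rw [hθ] at h2
      rw [← sub_pos, ← sinusoid_sub, hs]
      exact mul_pos hR (sin_pos_of_pos_of_lt_pi (by linarith) (by linarith))
    · rw [← sub_eq_zero, ← sinusoid_sub, hs, mul_eq_zero, or_iff_right hR.ne',
        sin_angle_sub_eq_zero_iff hmono hθ]
  adjacent k s t h h' := hadj k s t h h'

/-- With the polar angle taken in `[α, α + 2π)`, the hypotheses read `sin (ψ - α) > 0` and `sin (β -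
ψ) > 0`. The first forces `ψ < α + π`, and then `ψ ≥ β` contradicts the second. -/
theorem exists_polar {x y α β : ℝ} (hαβ : α < β)
    (h1 : 0 < -sin α * x + cos α * y) (h2 : 0 < sin β * x - cos β * y) :
    ∃ r ψ, 0 < r ∧ ψ ∈ Set.Ioo α β ∧ x = r * cos ψ ∧ y = r * sin ψ := by
  set z : ℂ := ⟨x, y⟩
  obtain ⟨ψ, ⟨hψ, hψ'⟩, m, hm⟩ := show ∃ ψ, ψ ∈ Set.Ico α (α + 2 * π) ∧
      ∃ m : ℤ, ψ = z.arg + m • (2 * π) by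
    obtain ⟨m, hm, -⟩ := existsUnique_add_zsmul_mem_Ico two_pi_pos z.arg α
    exact ⟨_, hm, m, rfl⟩
  have hx : x = ‖z‖ * cos ψ := by
    rw [hm, zsmul_eq_mul, cos_add_int_mul_two_pi]
    exact (Complex.norm_mul_cos_arg z).symm
  have hy : y = ‖z‖ * sin ψ := by
    rw [hm, zsmul_eq_mul, sin_add_int_mul_two_pi]
    exact (Complex.norm_mul_sin_arg z).symm
  have e1 : -sin α * x + cos α * y = ‖z‖ * sin (ψ - α) := by rw [sin_sub, hx, hy]; ring
  have e2 : sin β * x - cos β * y = ‖z‖ * sin (β - ψ) := by rw [sin_sub, hx, hy]; ring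
  rw [e1] at h1
  rw [e2] at h2
  have hr : 0 < ‖z‖ := lt_of_le_of_ne (norm_nonneg _) fun h => by simp [← h] at h1
  have s1 := (mul_pos_iff_of_pos_left hr).1 h1
  have s2 := (mul_pos_iff_of_pos_left hr).1 h2
  refine ⟨‖z‖, ψ, hr, ⟨lt_of_le_of_ne hψ fun h => by simp [h] at s1, ?_⟩, hx, hy⟩
  by_contra! hle
  have : ψ < α + π := by
    by_contra! hge
    have := sin_nonpos_of_nonpos_of_neg_pi_le (x := ψ - α - 2 * π) (by linarith) (by linarith)
    rw [sin_sub_two_pi] at this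
    linarith
  have := sin_nonpos_of_nonpos_of_neg_pi_le (x := β - ψ) (by linarith) (by linarith)
  linarith

/-- Enumeration of all translates by multiples of `π` of a finite set of angles. -/
theorem exists_angle_enumeration (F : Finset ℝ) (hF : ∀ x ∈ F, x ∈ Set.Ico 0 π)
    (hn : 0 < F.card) :
    ∃ θ : ℤ → ℝ, StrictMono θ ∧ (∀ k, θ (k + F.card) = θ k + π) ∧
      (∀ k, ∃ x ∈ F, ∃ m : ℤ, θ k = x + m * π) ∧ ∀ x ∈ F, ∃ k, θ k = x := by
  set n := F.card with hnF
  have hn' : (0 : ℤ) < n := by exact_mod_cast hn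
  let f := F.orderEmbOfFin hnF.symm
  have hlt : ∀ k : ℤ, (k % n).toNat < n := fun k => by
    have := Int.emod_lt_of_pos k hn'
    have := Int.emod_nonneg k hn'.ne'
    omega
  have hmem : ∀ i, f i ∈ F := fun i => F.orderEmbOfFin_mem hnF.symm i
  -- The remainder of `k` selects the angle and the quotient counts half turns.
  refine ⟨fun k => f ⟨(k % n).toNat, hlt k⟩ + (k / n : ℤ) * π, strictMono_int_of_lt_succ ?_,
    fun k => ?_, fun k => ⟨_, hmem _, _, rfl⟩, fun x hx => ?_⟩
  · intro k
    have e1 := Int.emod_add_mul_ediv k n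
    have e2 := Int.emod_nonneg k hn'.ne'
    have e3 := Int.emod_lt_of_pos k hn'
    rcases lt_or_ge (k % n + 1) n with h | h
    · have hq : (k + 1) / n = k / n ∧ (k + 1) % n = k % n + 1 :=
        (Int.ediv_emod_unique hn').2 ⟨by omega, by omega, h⟩
      simp only [hq.1]
      gcongr
      refine f.strictMono (Fin.mk_lt_mk.2 ?_)
      rw [hq.2]; omega
    · have hq : (k + 1) / n = k / n + 1 ∧ (k + 1) % n = 0 :=
        (Int.ediv_emod_unique hn').2 ⟨by rw [mul_add]; omega, le_rfl, hn'⟩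
      simp only [hq.1]
      have h1 := (hF _ (hmem ⟨(k % n).toNat, hlt k⟩)).2
      have h2 := (hF _ (hmem ⟨((k + 1) % n).toNat, hlt (k + 1)⟩)).1
      push_cast
      linarith
  · simp only [Int.add_emod_right, Int.add_ediv_of_dvd_right (dvd_refl (n : ℤ)),
      Int.ediv_self hn'.ne']
    push_cast; ring
  · have : x ∈ Set.range f := by rw [F.range_orderEmbOfFin]; exact hx
    obtain ⟨i, rfl⟩ := this
    refine ⟨i, ?_⟩
    have h1 : ((i : ℕ) : ℤ) % n = i := Int.emod_eq_of_lt (by omega) (by exact_mod_cast i.2)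
    have h2 : ((i : ℕ) : ℤ) / n = 0 := Int.ediv_eq_zero_of_lt (by omega) (by exact_mod_cast i.2)
    simp only [h1, h2]
    simp

end Angles

namespace HyperplaneArrangement

/-! ### Polygon incidences determine the dependencies of the normals -/

section Polygon

variable {n : ℕ}

/-- Normal vectors of `n` hyperplanes through the third axis, at the angles `θ k`, and of `n`
hyperplanes that do not contain it. -/
noncomputable def axialNormals (θ : Fin n → ℝ) (p : Fin n → ℝ × ℝ) :
    Fin n ⊕ Fin n → (Fin 3 → ℝ)
  | Sum.inl k => ![-sin (θ k), cos (θ k), 0]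
  | Sum.inr i => ![(p i).1, (p i).2, 1]

/-- The incidences of the sides and the symmetry axes of a regular `n`-gon. -/
structure HasPolygonIncidences (θ : Fin n → ℝ) (p : Fin n → ℝ × ℝ) : Prop where
  sin_ne_zero : ∀ k l, k ≠ l → sin (θ l - θ k) ≠ 0
  sinusoid_eq_iff : ∀ i j k, i ≠ j →
    (sinusoid (p i) (θ k) = sinusoid (p j) (θ k) ↔
      (n : ℤ) ∣ ((k : ℕ) : ℤ) - ((i : ℕ) + (j : ℕ) + 1))

theorem Fin.eq_of_intCast_dvd_sub {i j : Fin n} (h : (n : ℤ) ∣ ((i : ℕ) : ℤ) - (j : ℕ)) :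
    i = j := by
  have := Int.eq_zero_of_abs_lt_dvd h (by rw [abs_lt]; omega)
  exact Fin.ext (by omega)

/-- The dependent triples of the normal vectors in the situation of `HasPolygonIncidences`. -/
def PolygonDependent : Fin n ⊕ Fin n → Fin n ⊕ Fin n → Fin n ⊕ Fin n → Prop
  | .inl _, .inl _, .inl _ => True
  | .inl k, .inl l, .inr _ => k = l
  | .inl k, .inr _, .inl l => k = l
  | .inr _, .inl k, .inl l => k = l
  | .inl k, .inr i, .inr j => i = j ∨ (n : ℤ) ∣ ((k : ℕ) : ℤ) - ((i : ℕ) + (j : ℕ) + 1)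
  | .inr i, .inl k, .inr j => i = j ∨ (n : ℤ) ∣ ((k : ℕ) : ℤ) - ((i : ℕ) + (j : ℕ) + 1)
  | .inr i, .inr j, .inl k => i = j ∨ (n : ℤ) ∣ ((k : ℕ) : ℤ) - ((i : ℕ) + (j : ℕ) + 1)
  | .inr i, .inr j, .inr l => i = j ∨ i = l ∨ j = l

/-- At the wall `k ≡ i + j + 1` the sinusoids of `p i` and `p j` agree. If the three points were
collinear, that of `p l` would agree as well, giving `i + l ≡ i + j` modulo `n`. -/
theorem HasPolygonIncidences.cross_ne_zero {θ : Fin n → ℝ} {p : Fin n → ℝ × ℝ}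
    (h : HasPolygonIncidences θ p) (hn : 2 ≤ n) {i j l : Fin n} (hij : i ≠ j) (hil : i ≠ l)
    (hjl : j ≠ l) :
    ((p j).1 - (p i).1) * ((p l).2 - (p i).2) - ((p j).2 - (p i).2) * ((p l).1 - (p i).1) ≠ 0 := by
  intro h0
  have hn0 : (0 : ℤ) < n := by omega
  have e1 := Int.emod_nonneg ((i : ℕ) + (j : ℕ) + 1 : ℤ) hn0.ne'
  have e2 := Int.emod_lt_of_pos ((i : ℕ) + (j : ℕ) + 1 : ℤ) hn0
  have e3 := Int.emod_add_mul_ediv ((i : ℕ) + (j : ℕ) + 1 : ℤ) n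
  set k : Fin n := ⟨(((i : ℕ) + (j : ℕ) + 1 : ℤ) % n).toNat, by omega⟩ with hk
  have hkv : ((k : ℕ) : ℤ) = ((i : ℕ) + (j : ℕ) + 1 : ℤ) % n := by rw [hk]; simp; omega
  have hd : (n : ℤ) ∣ ((k : ℕ) : ℤ) - ((i : ℕ) + (j : ℕ) + 1) :=
    ⟨-(((i : ℕ) + (j : ℕ) + 1 : ℤ) / n), by rw [hkv, mul_neg]; omega⟩
  have hZ := (h.sinusoid_eq_iff i j k hij).2 hd
  have hne : p j - p i ≠ 0 := by
    intro hp
    have hp : p i = p j := (sub_eq_zero.1 hp).symm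
    have d0 := (h.sinusoid_eq_iff i j ⟨0, by omega⟩ hij).1 (by rw [hp])
    have d1 := (h.sinusoid_eq_iff i j ⟨1, by omega⟩ hij).1 (by rw [hp])
    have := dvd_sub d1 d0
    simp only [Nat.cast_one, Nat.cast_zero] at this
    rw [show (1 : ℤ) - ((i : ℕ) + (j : ℕ) + 1) - (0 - ((i : ℕ) + (j : ℕ) + 1)) = 1 by ring] at this
    have := Int.le_of_dvd one_pos this
    omega
  have hZ' : sinusoid (p i) (θ k) = sinusoid (p l) (θ k) := by
    simp only [sinusoid] at hZ ⊢
    have a1 : ((p j).1 - (p i).1) *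
        ((p l).1 * cos (θ k) + (p l).2 * sin (θ k) -
          ((p i).1 * cos (θ k) + (p i).2 * sin (θ k))) = 0 := by
      linear_combination sin (θ k) * h0 - ((p l).1 - (p i).1) * hZ
    have a2 : ((p j).2 - (p i).2) *
        ((p l).1 * cos (θ k) + (p l).2 * sin (θ k) -
          ((p i).1 * cos (θ k) + (p i).2 * sin (θ k))) = 0 := by
      linear_combination -cos (θ k) * h0 - ((p l).2 - (p i).2) * hZ
    by_contra hc
    have hc' : (p l).1 * cos (θ k) + (p l).2 * sin (θ k) -
          ((p i).1 * cos (θ k) + (p i).2 * sin (θ k)) ≠ 0 := fun h => hc (sub_eq_zero.1 h).symm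
    exact hne (Prod.ext ((mul_eq_zero.1 a1).resolve_right hc')
      ((mul_eq_zero.1 a2).resolve_right hc'))
  have := dvd_sub ((h.sinusoid_eq_iff i l k hil).1 hZ') hd
  refine hjl (Fin.eq_of_intCast_dvd_sub ?_)
  rwa [show ((k : ℕ) : ℤ) - ((i : ℕ) + (l : ℕ) + 1) - ((k : ℕ) - ((i : ℕ) + (j : ℕ) + 1)) =
    (j : ℕ) - (l : ℕ) by ring] at this

theorem HasPolygonIncidences.det_eq_zero_iff {θ : Fin n → ℝ} {p : Fin n → ℝ × ℝ}
    (h : HasPolygonIncidences θ p) (hn : 2 ≤ n) (x y z : Fin n ⊕ Fin n) :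
    (Matrix.of ![axialNormals θ p x, axialNormals θ p y, axialNormals θ p z]).det = 0 ↔
      PolygonDependent x y z := by
  have hsin : ∀ k l, sin (θ l - θ k) = 0 ↔ k = l := fun k l =>
    ⟨fun h0 => by_contra fun hkl => h.sin_ne_zero k l hkl h0, by rintro rfl; simp⟩
  have hw : ∀ i j k, sinusoid (p i) (θ k) - sinusoid (p j) (θ k) = 0 ↔
      i = j ∨ (n : ℤ) ∣ ((k : ℕ) : ℤ) - ((i : ℕ) + (j : ℕ) + 1) := fun i j k => by
    rw [sub_eq_zero]
    rcases eq_or_ne i j with rfl | hij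
    · simp
    · simp [hij, h.sinusoid_eq_iff i j k hij]
  rw [Matrix.det_fin_three]
  rcases x with k | i <;> rcases y with l | j <;> rcases z with m | m <;>
    simp only [axialNormals, PolygonDependent, Matrix.of_apply, Matrix.cons_val]
  · simp
  · rw [← hsin, sin_sub]; ring_nf
  · rw [← hsin, sin_sub, ← neg_eq_zero]; ring_nf
  · rw [← hw, sinusoid, sinusoid, ← neg_eq_zero]; ring_nf
  · rw [← hsin, sin_sub]; ring_nf
  · rw [← hw, sinusoid, sinusoid]; ring_nf
  · rw [← hw, sinusoid, sinusoid, ← neg_eq_zero]; ring_nf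
  · constructor
    · intro h0
      by_contra! hne
      refine h.cross_ne_zero hn hne.1 hne.2.1 hne.2.2 ?_
      linear_combination h0
    · rintro (rfl | rfl | rfl) <;> ring

/-- Every pair extends to a triple with nonzero determinant. For two slanted normals one of the
walls 0 and 1 serves, as they cannot both be incident. -/
theorem HasPolygonIncidences.linearIndependent_pair {θ : Fin n → ℝ} {p : Fin n → ℝ × ℝ}
    (h : HasPolygonIncidences θ p) (hn : 2 ≤ n) {x y : Fin n ⊕ Fin n} (hxy : x ≠ y) :
    LinearIndependent ℝ ![axialNormals θ p x, axialNormals θ p y] := by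
  obtain ⟨z, hz⟩ : ∃ z, ¬ PolygonDependent x y z := by
    rcases x with k | i <;> rcases y with l | j
    · exact ⟨.inr k, fun h => hxy (by rw [show k = l from h])⟩
    · have : Nontrivial (Fin n) := Fin.nontrivial_iff_two_le.2 hn
      obtain ⟨l, hl⟩ := exists_ne k
      exact ⟨.inl l, fun h => hl (show k = l from h).symm⟩
    · have : Nontrivial (Fin n) := Fin.nontrivial_iff_two_le.2 hn
      obtain ⟨k, hk⟩ := exists_ne l
      exact ⟨.inl k, fun h => hk (show l = k from h).symm⟩
    · by_contra! hall
      have hij : i ≠ j := fun h => hxy (by rw [h])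
      have d0 := (hall (.inl ⟨0, by omega⟩)).resolve_left hij
      have d1 := (hall (.inl ⟨1, by omega⟩)).resolve_left hij
      have := dvd_sub d1 d0
      simp only [Nat.cast_one, Nat.cast_zero] at this
      rw [show (1 : ℤ) - ((i : ℕ) + (j : ℕ) + 1) - (0 - ((i : ℕ) + (j : ℕ) + 1)) = 1 by ring]
        at this
      have := Int.le_of_dvd one_pos this
      omega
  rw [← h.det_eq_zero_iff hn, ← Ne, ← isUnit_iff_ne_zero, ← Matrix.isUnit_iff_isUnit_det,
    ← Matrix.linearIndependent_rows_iff_isUnit] at hz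
  have := hz.comp (Fin.castSucc : Fin 2 → Fin 3) (Fin.castSucc_injective 2)
  have he : (Matrix.of ![axialNormals θ p x, axialNormals θ p y, axialNormals θ p z]).row ∘
      Fin.castSucc = ![axialNormals θ p x, axialNormals θ p y] := by
    funext i
    fin_cases i <;> rfl
  rwa [he] at this

theorem HasPolygonIncidences.axialNormals_ne_zero {θ : Fin n → ℝ} {p : Fin n → ℝ × ℝ}
    (h : HasPolygonIncidences θ p) (hn : 2 ≤ n) (x : Fin n ⊕ Fin n) : axialNormals θ p x ≠ 0 := by
  obtain ⟨y, hy⟩ : ∃ y, y ≠ x := by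
    rcases x with k | i
    exacts [⟨.inr k, Sum.inr_ne_inl⟩, ⟨.inl i, Sum.inl_ne_inr⟩]
  exact (h.linearIndependent_pair hn hy).ne_zero 1

theorem HasPolygonIncidences.mem_span_iff {θ θ' : Fin n → ℝ} {p p' : Fin n → ℝ × ℝ}
    (h : HasPolygonIncidences θ p) (h' : HasPolygonIncidences θ' p') (hn : 2 ≤ n)
    (T : Set (Fin n ⊕ Fin n)) (m : Fin n ⊕ Fin n) :
    axialNormals θ p m ∈ Submodule.span ℝ (axialNormals θ p '' T) ↔
      axialNormals θ' p' m ∈ Submodule.span ℝ (axialNormals θ' p' '' T) := by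
  exact ⟨mem_span_image_of_det_eq_zero_iff (fun i j => h.linearIndependent_pair hn) (h.axialNormals_ne_zero hn)
      (fun i j => h'.linearIndependent_pair hn)
      (fun i j k => by rw [h.det_eq_zero_iff hn, h'.det_eq_zero_iff hn]) T m,
    mem_span_image_of_det_eq_zero_iff (fun i j => h'.linearIndependent_pair hn) (h'.axialNormals_ne_zero hn)
      (fun i j => h.linearIndependent_pair hn)
      (fun i j k => by rw [h.det_eq_zero_iff hn, h'.det_eq_zero_iff hn]) T m⟩

theorem axialNormals_eq_normalsA2n1 :
    axialNormals (fun k : Fin n => 2 * π * (k : ℕ) / (2 * n))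
      (fun k => (cos (2 * π * (2 * (k : ℕ) + 1) / (2 * n)),
        sin (2 * π * (2 * (k : ℕ) + 1) / (2 * n)))) = normalsA2n1 n := by
  funext x
  rcases x with k | k <;> rfl

/-- The sinusoid of the unit vector at angle `φ` is `cos (φ - ψ)`. A difference of two such cosines
is a product of two sines: the half sum yields the stated divisibility, and the half difference does
not vanish for `i ≠ j`. -/
theorem hasPolygonIncidences_A2n1 (hn : n ≠ 0) :
    HasPolygonIncidences (fun k : Fin n => 2 * π * (k : ℕ) / (2 * n))
      (fun k => (cos (2 * π * (2 * (k : ℕ) + 1) / (2 * n)),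
        sin (2 * π * (2 * (k : ℕ) + 1) / (2 * n)))) where
  sin_ne_zero k l hkl h0 := by
    have hn' : (n : ℝ) ≠ 0 := by exact_mod_cast hn
    have : 2 * π * (l : ℕ) / (2 * n) - 2 * π * (k : ℕ) / (2 * n) =
        π * (((l : ℕ) - (k : ℕ) : ℤ) : ℝ) / n := by
      push_cast; field_simp
    rw [this, sin_int_mul_pi_div_eq_zero_iff hn] at h0
    exact hkl (Fin.eq_of_intCast_dvd_sub h0).symm
  sinusoid_eq_iff i j k hij := by
    have hn' : (n : ℝ) ≠ 0 := by exact_mod_cast hn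
    have hs : ∀ φ ψ, sinusoid (cos φ, sin φ) ψ = cos (φ - ψ) := fun φ ψ => by
      rw [sinusoid, cos_sub]
    rw [hs, hs, ← sub_eq_zero, cos_sub_cos]
    rw [show (2 * π * (2 * (i : ℕ) + 1) / (2 * n) - 2 * π * (k : ℕ) / (2 * n) +
        (2 * π * (2 * (j : ℕ) + 1) / (2 * n) - 2 * π * (k : ℕ) / (2 * n))) / 2 =
        π * (((i : ℕ) + (j : ℕ) + 1 - (k : ℕ) : ℤ) : ℝ) / n by push_cast; field_simp; ring,
      show (2 * π * (2 * (i : ℕ) + 1) / (2 * n) - 2 * π * (k : ℕ) / (2 * n) -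
        (2 * π * (2 * (j : ℕ) + 1) / (2 * n) - 2 * π * (k : ℕ) / (2 * n))) / 2 =
        π * (((i : ℕ) - (j : ℕ) : ℤ) : ℝ) / n by push_cast; field_simp; ring]
    have hne : ¬ (n : ℤ) ∣ ((i : ℕ) : ℤ) - (j : ℕ) := fun h => hij (Fin.eq_of_intCast_dvd_sub h)
    rw [mul_eq_zero, mul_eq_zero, sin_int_mul_pi_div_eq_zero_iff hn,
      sin_int_mul_pi_div_eq_zero_iff hn, dvd_sub_comm]
    simp [hne]

end Polygon

end HyperplaneArrangement

namespace HyperplaneArrangement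

/-! ### Counting walls of a simplicial chamber -/

section Chambers

variable {V : Type*} [AddCommGroup V] [Module ℝ V] [TopologicalSpace V] [IsTopologicalAddGroup V]
  [ContinuousSMul ℝ V]

/-- A chamber of a simplicial arrangement that contains an open polyhedral cone
`{v | ∀ j, 0 < g j v}`, each facet of which lies in a hyperplane, has at least as many walls as the
cone has facets. -/
theorem IsSimplicial.card_le_finrank {A : HyperplaneArrangement ℝ V} (hA : A.IsSimplicial)
    {J : Type*} [Fintype J] (g : J → Module.Dual ℝ V) (x : V) (hx : ∀ j, 0 < g j x)
    (hD : ∀ v, (∀ j, 0 < g j v) → v ∈ A.complement) (w : J → V) (hw : ∀ j, g j (w j) = 0)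
    (hw' : ∀ j l, l ≠ j → 0 < g l (w j)) (hwA : ∀ j, w j ∉ A.complement) :
    Fintype.card J ≤ Module.finrank ℝ V := by
  have hconv : Convex ℝ {v : V | ∀ j, 0 < g j v} := by
    simp only [Set.ofPred_forall]
    exact convex_iInter fun j => convex_halfSpace_gt (g j).isLinear 0
  have hsub : {v : V | ∀ j, 0 < g j v} ⊆ connectedComponentIn A.complement x :=
    hconv.isPreconnected.subset_connectedComponentIn hx hD
  obtain ⟨b, hb⟩ := hA _ ⟨x, hD x hx, rfl⟩
  have hpos : ∀ v, (∀ j, 0 < g j v) → ∀ i, 0 < b.repr v i := fun v hv => by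
    have := hsub hv
    rw [hb] at this
    exact this
  -- Adding the positive multiple of `x` that makes the negative `i`-th coordinate exactly zero
  -- gives a point of the open cone outside the chamber.
  have hnonneg : ∀ v, (∀ j, 0 ≤ g j v) → ∀ i, 0 ≤ b.repr v i := by
    intro v hv i
    by_contra! hlt
    have hxi := hpos x hx i
    have := hpos (v + (-(b.repr v i) / b.repr x i) • x) (fun j => by
      have : 0 < -(b.repr v i) / b.repr x i := div_pos (by linarith) hxi
      simp only [map_add, map_smul, smul_eq_mul]
      nlinarith [hv j, mul_pos this (hx j)]) i
    simp only [map_add, map_smul, Finsupp.add_apply, Finsupp.smul_apply, smul_eq_mul] at this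
    rw [div_mul_cancel₀ _ hxi.ne'] at this
    linarith
  have hw0 : ∀ j l, 0 ≤ g l (w j) := fun j l => by
    rcases eq_or_ne l j with rfl | h
    · exact (hw l).ge
    · exact (hw' j l h).le
  -- The point `w j` lies on the closed simplicial cone but outside the chamber, so some coordinate
  -- vanishes; `f j` records one.
  have hzero : ∀ j, ∃ i, b.repr (w j) i = 0 := by
    intro j
    by_contra! hne
    refine hwA j (connectedComponentIn_subset _ x ?_)
    rw [hb]
    exact fun i => lt_of_le_of_ne (hnonneg _ (hw0 j) i) (hne i).symm
  choose f hf using hzero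
  -- A small move from `w j` inside its facet stays in the closed cone. Using both `y` and `-y`, the
  -- coordinate `f j` vanishes on the kernel of `g j`.
  have hker0 : ∀ j y, g j y = 0 → 0 ≤ b.repr y (f j) := by
    intro j y hy
    have hev : ∀ᶠ ε in nhdsWithin (0 : ℝ) (Set.Ioi 0), ∀ l, l ≠ j →
        0 < g l (w j) + ε * g l y := by
      refine Filter.eventually_all.2 fun l => ?_
      rcases eq_or_ne l j with rfl | h
      · simp
      have hc : ContinuousAt (fun ε : ℝ => g l (w j) + ε * g l y) 0 := by fun_prop
      have := hc.eventually (lt_mem_nhds (a := 0) (by simpa using hw' j l h))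
      exact (this.filter_mono nhdsWithin_le_nhds).mono fun _ h _ => h
    obtain ⟨ε, hε, hεpos⟩ := (hev.and self_mem_nhdsWithin).exists
    have := hnonneg (w j + ε • y) (fun l => by
      simp only [map_add, map_smul, smul_eq_mul]
      rcases eq_or_ne l j with rfl | h
      · simp [hw, hy]
      · exact (hε l h).le) (f j)
    simp only [map_add, map_smul, Finsupp.add_apply, Finsupp.smul_apply, smul_eq_mul, hf,
      zero_add] at this
    exact nonneg_of_mul_nonneg_right this hεpos
  have hker : ∀ j y, g j y = 0 → b.repr y (f j) = 0 := by
    intro j y hy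
    have h1 := hker0 j y hy
    have h2 := hker0 j (-y) (by simp [hy])
    simp only [map_neg, Finsupp.neg_apply] at h2
    linarith
  -- Project `w l` along `x` into the kernel of `g j`. If `f j = f l`, the coordinate vanishes at `w
  -- l` and at the projection, but it is positive at `x`, and a positive multiple of `x` was
  -- subtracted.
  have hinj : Function.Injective f := by
    intro j l hjl
    by_contra hne
    have h1 := hw' l j hne
    have h2 := hker j (w l - (g j (w l) / g j x) • x) (by
      simp only [map_sub, map_smul, smul_eq_mul, div_mul_cancel₀ _ (hx j).ne', sub_self])
    rw [hjl] at h2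
    simp only [map_sub, map_smul, Finsupp.sub_apply, Finsupp.smul_apply, smul_eq_mul, hf] at h2
    have := mul_pos (div_pos h1 (hx j)) (hpos x hx (f l))
    linarith
  simpa using Fintype.card_le_of_injective f hinj

end Chambers

/-! ### A criterion for reducibility -/

section Reducible

variable {K V : Type*} [Field K] [AddCommGroup V] [Module K V]

theorem exists_dual_ker_eq {H : Submodule K V} (hH : Module.finrank K (V ⧸ H) = 1) :
    ∃ α : Module.Dual K V, α ≠ 0 ∧ LinearMap.ker α = H := by
  have : Module.Finite K (V ⧸ H) := Module.finite_of_finrank_pos (by omega)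
  let e : (V ⧸ H) ≃ₗ[K] K := LinearEquiv.ofFinrankEq _ _ (by rw [hH, Module.finrank_self])
  have hker : LinearMap.ker (e.toLinearMap ∘ₗ H.mkQ) = H := by
    rw [LinearMap.ker_comp, LinearEquiv.ker, Submodule.comap_bot, Submodule.ker_mkQ]
  refine ⟨e.toLinearMap ∘ₗ H.mkQ, fun h0 => ?_, hker⟩
  rw [h0, LinearMap.ker_zero] at hker
  subst hker
  have := Module.finrank_zero_of_subsingleton (R := K) (M := V ⧸ (⊤ : Submodule K V))
  omega

theorem eq_of_le_of_codim_one {H H' : Submodule K V} (hH : Module.finrank K (V ⧸ H) = 1)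
    (hH' : Module.finrank K (V ⧸ H') = 1) (hle : H ≤ H') : H = H' := by
  obtain ⟨α, hα, rfl⟩ := exists_dual_ker_eq hH
  obtain ⟨β, hβ, rfl⟩ := exists_dual_ker_eq hH'
  refine le_antisymm hle fun v hv => ?_
  obtain ⟨u, hu⟩ := DFunLike.ne_iff.1 hβ
  have h1 : α u ≠ 0 := fun h => hu (hle h)
  have h2 : α (v - (α v / α u) • u) = 0 := by simp [h1]
  have h3 : β (v - (α v / α u) • u) = 0 := hle h2
  rw [LinearMap.mem_ker] at hv ⊢
  simp only [map_sub, hv, map_smul, smul_eq_mul, zero_sub, neg_eq_zero] at h3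
  rcases mul_eq_zero.1 h3 with h | h
  · exact (div_eq_zero_iff.1 h).resolve_right h1
  · exact absurd h hu

theorem finrank_quotient_comap_subtype {H H' : Submodule K V}
    (hH : Module.finrank K (V ⧸ H) = 1) (hH' : Module.finrank K (V ⧸ H') = 1) (hne : H ≠ H') :
    Module.finrank K (H' ⧸ H.comap H'.subtype) = 1 := by
  obtain ⟨β, -, hβ⟩ := exists_dual_ker_eq hH
  have h : H.comap H'.subtype = LinearMap.ker (β ∘ₗ H'.subtype) := by
    rw [LinearMap.ker_comp, hβ]
  rw [h]
  refine finrank_quotient_ker_eq_one _ fun h0 => hne ?_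
  refine (eq_of_le_of_codim_one hH' hH fun v hv => ?_).symm
  rw [← hβ]
  exact LinearMap.congr_fun h0 ⟨v, hv⟩

/-- If all hyperplanes but one contain a common vector, and the remaining one does not, then the
arrangement is reducible. -/
theorem isReducible_of_forall_ne_mem (A : HyperplaneArrangement K V) {H₁ : Submodule K V}
    (hH₁ : H₁ ∈ A.hyperplanes) (hbot : H₁ ≠ ⊥) {q : V} (hq : q ∉ H₁)
    (h : ∀ H ∈ A.hyperplanes, H ≠ H₁ → q ∈ H) : A.IsReducible := by
  obtain ⟨α, -, hα⟩ := exists_dual_ker_eq (A.codim_one H₁ hH₁)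
  have hαq : α q ≠ 0 := fun h0 => hq (hα ▸ h0)
  have hq0 : q ≠ 0 := fun h0 => hq (h0 ▸ H₁.zero_mem)
  have hcompl : IsCompl (Submodule.span K {q}) H₁ := by
    constructor
    · rw [Submodule.disjoint_def]
      intro v hv hvH
      obtain ⟨c, rfl⟩ := Submodule.mem_span_singleton.1 hv
      rw [← hα, LinearMap.mem_ker, map_smul, smul_eq_mul] at hvH
      rw [(mul_eq_zero.1 hvH).resolve_right hαq, zero_smul]
    · rw [codisjoint_iff, eq_top_iff]
      intro v _
      refine Submodule.mem_sup.2 ⟨(α v / α q) • q, Submodule.smul_mem _ _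
        (Submodule.mem_span_singleton_self q), v - (α v / α q) • q, ?_, by abel⟩
      rw [← hα, LinearMap.mem_ker]
      simp [hαq]
  -- The factor on the line through `q` contributes `H₁` alone; the factor in `H₁` consists of the
  -- traces of the other hyperplanes, which all contain `q`.
  refine ⟨Submodule.span K {q}, H₁, ⟨{⊥}, Set.finite_singleton _, ?_⟩,
    ⟨(fun H => H.comap H₁.subtype) '' {H | H ∈ A.hyperplanes ∧ H ≠ H₁},
      (A.finite.subset fun _ h => h.1).image _, ?_⟩, hcompl, by simpa using hq0, hbot, ?_⟩
  · rintro _ rfl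
    rw [(Submodule.quotEquivOfEqBot _ rfl).finrank_eq, finrank_span_singleton hq0]
  · rintro _ ⟨H, ⟨hH, hne⟩, rfl⟩
    exact finrank_quotient_comap_subtype (A.codim_one H hH) (A.codim_one H₁ hH₁) hne
  · have hdecomp : ∀ H ∈ A.hyperplanes, H ≠ H₁ →
        Submodule.span K {q} ⊔ (H.comap H₁.subtype).map H₁.subtype = H := by
      intro H hH hne
      have hle : Submodule.span K {q} ≤ H := by
        rw [Submodule.span_singleton_le_iff_mem]; exact h H hH hne
      rw [Submodule.map_comap_subtype, ← sup_inf_assoc_of_le _ hle, hcompl.sup_eq_top,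
        top_inf_eq]
    ext H
    constructor
    · intro hH
      by_cases hne : H = H₁
      · exact Or.inl ⟨⊥, rfl, by simp [hne]⟩
      · exact Or.inr ⟨_, ⟨H, ⟨hH, hne⟩, rfl⟩, (hdecomp H hH hne).symm⟩
    · rintro (⟨_, rfl, rfl⟩ | ⟨_, ⟨H', ⟨hH', hne⟩, rfl⟩, rfl⟩)
      · simpa using hH₁
      · rw [hdecomp H' hH' hne]; exact hH'

end Reducible

/-! ### Coordinates with `X` as third axis -/

section Coordinates

variable {V : Type*} [AddCommGroup V] [Module ℝ V]

/-- The linear form with coefficients `c` in the coordinates of a basis. -/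
noncomputable def formOfBasis (b : Module.Basis (Fin 3) ℝ V) :
    (Fin 3 → ℝ) ≃ₗ[ℝ] Module.Dual ℝ V := b.constr ℝ

theorem formOfBasis_apply (b : Module.Basis (Fin 3) ℝ V) (c : Fin 3 → ℝ) (v : V) :
    formOfBasis b c v =
      c 0 * b.equivFun v 0 + c 1 * b.equivFun v 1 + c 2 * b.equivFun v 2 := by
  simp only [formOfBasis, Module.Basis.constr_apply_fintype, Fin.sum_univ_three, smul_eq_mul]
  ring

theorem formOfBasis_basisFun (c : Fin 3 → ℝ) :
    formOfBasis (Pi.basisFun ℝ (Fin 3)) c = formOfNormal c := by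
  ext v
  simp [formOfBasis_apply, formOfNormal, dotProduct, Fin.sum_univ_three]

theorem formOfBasis_equivFun_symm (b : Module.Basis (Fin 3) ℝ V) (c : Fin 3 → ℝ) (x y z : ℝ) :
    formOfBasis b c (b.equivFun.symm ![x, y, z]) = c 0 * x + c 1 * y + c 2 * z := by
  rw [formOfBasis_apply, LinearEquiv.apply_symm_apply]; rfl

theorem exists_formOfBasis_ker_eq (b : Module.Basis (Fin 3) ℝ V) {H : Submodule ℝ V}
    (hH : Module.finrank ℝ (V ⧸ H) = 1) :
    ∃ c : Fin 3 → ℝ, c ≠ 0 ∧ LinearMap.ker (formOfBasis b c) = H := by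
  obtain ⟨α, hα, h⟩ := exists_dual_ker_eq hH
  refine ⟨(formOfBasis b).symm α, by simpa using hα, by simpa using h⟩

theorem ker_formOfBasis_smul (b : Module.Basis (Fin 3) ℝ V) {r : ℝ} (hr : r ≠ 0)
    (c : Fin 3 → ℝ) :
    LinearMap.ker (formOfBasis b (r • c)) = LinearMap.ker (formOfBasis b c) := by
  rw [map_smul, LinearMap.ker_smul _ _ hr]

/-- The hyperplane at the angle `θ` through the third coordinate axis. -/
noncomputable def axialHyperplane (b : Module.Basis (Fin 3) ℝ V) (θ : ℝ) : Submodule ℝ V :=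
  LinearMap.ker (formOfBasis b ![-sin θ, cos θ, 0])

/-- The hyperplane `p₁ x + p₂ y + z = 0`. -/
noncomputable def slantHyperplane (b : Module.Basis (Fin 3) ℝ V) (p : ℝ × ℝ) : Submodule ℝ V :=
  LinearMap.ker (formOfBasis b ![p.1, p.2, 1])

/-- The point in direction `ψ` with third coordinate `z`. -/
noncomputable def cylinderPoint (b : Module.Basis (Fin 3) ℝ V) (ψ z : ℝ) : V :=
  b.equivFun.symm ![cos ψ, sin ψ, z]

variable (b : Module.Basis (Fin 3) ℝ V)

theorem axialForm_cylinderPoint (θ ψ z : ℝ) :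
    formOfBasis b ![-sin θ, cos θ, 0] (cylinderPoint b ψ z) = sin (ψ - θ) := by
  rw [cylinderPoint, formOfBasis_equivFun_symm, sin_sub]
  simp; ring

theorem slantForm_cylinderPoint (p : ℝ × ℝ) (ψ z : ℝ) :
    formOfBasis b ![p.1, p.2, 1] (cylinderPoint b ψ z) = sinusoid p ψ + z := by
  rw [cylinderPoint, formOfBasis_equivFun_symm, sinusoid]
  simp

theorem cylinderPoint_mem_axialHyperplane {θ ψ z : ℝ} :
    cylinderPoint b ψ z ∈ axialHyperplane b θ ↔ sin (ψ - θ) = 0 := by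
  rw [axialHyperplane, LinearMap.mem_ker, axialForm_cylinderPoint]

theorem cylinderPoint_mem_slantHyperplane {p : ℝ × ℝ} {ψ z : ℝ} :
    cylinderPoint b ψ z ∈ slantHyperplane b p ↔ sinusoid p ψ + z = 0 := by
  rw [slantHyperplane, LinearMap.mem_ker, slantForm_cylinderPoint]

theorem axialHyperplane_add_int_mul_pi (θ : ℝ) (m : ℤ) :
    axialHyperplane b (θ + m * π) = axialHyperplane b θ := by
  rw [axialHyperplane, axialHyperplane, sin_add_int_mul_pi, cos_add_int_mul_pi,
    ← ker_formOfBasis_smul b (r := (-1) ^ m) (zpow_ne_zero _ (by norm_num)) ![-sin θ, cos θ, 0]]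
  congr 2
  funext i
  fin_cases i <;> simp

theorem sin_sub_eq_zero_of_axialHyperplane_eq {θ θ' : ℝ}
    (h : axialHyperplane b θ = axialHyperplane b θ') : sin (θ - θ') = 0 := by
  have : cylinderPoint b θ 0 ∈ axialHyperplane b θ := by
    rw [cylinderPoint_mem_axialHyperplane]; simp
  rwa [h, cylinderPoint_mem_axialHyperplane] at this

theorem exists_axialHyperplane_eq {c : Fin 3 → ℝ} (hc : c ≠ 0) (h2 : c 2 = 0) :
    ∃ θ ∈ Set.Ico 0 π, LinearMap.ker (formOfBasis b c) = axialHyperplane b θ := by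
  -- The normal `(c 0, c 1)` is to be proportional to `(-sin θ, cos θ)`, so `θ` is the argument of
  -- this number, reduced modulo `π`.
  set z : ℂ := ⟨c 1, -c 0⟩
  have hz : ‖z‖ ≠ 0 := by
    intro h
    have hz0 : z = 0 := norm_eq_zero.1 h
    have h1 : c 1 = 0 := congrArg Complex.re hz0
    have h0 : -c 0 = 0 := congrArg Complex.im hz0
    refine hc ?_
    funext i
    fin_cases i
    exacts [neg_eq_zero.1 h0, h1, h2]
  have hx : ‖z‖ * cos z.arg = c 1 := Complex.norm_mul_cos_arg z
  have hy : ‖z‖ * sin z.arg = -c 0 := Complex.norm_mul_sin_arg z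
  obtain ⟨m, hm, -⟩ := existsUnique_add_zsmul_mem_Ico pi_pos z.arg 0
  rw [zero_add, zsmul_eq_mul] at hm
  refine ⟨_, hm, ?_⟩
  rw [axialHyperplane_add_int_mul_pi, axialHyperplane, ← ker_formOfBasis_smul b hz ![-sin z.arg, cos z.arg, 0]]
  congr 2
  funext i
  fin_cases i <;> simp [hx, hy, h2]

theorem exists_slantHyperplane_eq {c : Fin 3 → ℝ} (h2 : c 2 ≠ 0) :
    ∃ p, LinearMap.ker (formOfBasis b c) = slantHyperplane b p := by
  refine ⟨(c 0 / c 2, c 1 / c 2), ?_⟩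
  rw [slantHyperplane, ← ker_formOfBasis_smul b h2 ![c 0 / c 2, c 1 / c 2, 1]]
  congr 2
  funext i
  fin_cases i <;> simp [mul_div_cancel₀, h2]

theorem exists_basis_adapted [FiniteDimensional ℝ V] (hV : Module.finrank ℝ V = 3)
    {X : Submodule ℝ V} (hX : Module.finrank ℝ (V ⧸ X) = 2) :
    ∃ b : Module.Basis (Fin 3) ℝ V, X = Submodule.span ℝ {b 2} := by
  obtain ⟨C, hC⟩ := X.exists_isCompl
  have h1 : Module.finrank ℝ X = 1 := by
    have := X.finrank_quotient_add_finrank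
    omega
  have h2 : Module.finrank ℝ C = 2 := by
    rw [← hX]; exact (Submodule.quotientEquivOfIsCompl X C hC).finrank_eq.symm
  let b : Module.Basis (Fin 3) ℝ V :=
    (((Module.finBasisOfFinrankEq ℝ C h2).prod (Module.finBasisOfFinrankEq ℝ X h1)).map
      (Submodule.prodEquivOfIsCompl C X hC.symm)).reindex finSumFinEquiv
  have hb : b 2 = (Module.finBasisOfFinrankEq ℝ X h1 0 : V) := by
    have : (2 : Fin 3) = finSumFinEquiv (Sum.inr (0 : Fin 1)) := rfl
    simp only [b, this, Module.Basis.reindex_apply, Equiv.symm_apply_apply]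
    simp
  refine ⟨b, ?_⟩
  have hle : Submodule.span ℝ {b 2} ≤ X := by
    rw [Submodule.span_singleton_le_iff_mem, hb]; exact SetLike.coe_mem _
  refine (Submodule.eq_of_le_of_finrank_eq hle ?_).symm
  rw [h1, finrank_span_singleton (b.ne_zero 2)]

theorem span_le_ker_formOfBasis_iff (c : Fin 3 → ℝ) :
    Submodule.span ℝ {b 2} ≤ LinearMap.ker (formOfBasis b c) ↔ c 2 = 0 := by
  rw [Submodule.span_singleton_le_iff_mem, LinearMap.mem_ker, formOfBasis_apply]
  simp

end Coordinates

end HyperplaneArrangement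

namespace HyperplaneArrangement

/-! ### From the arrangement to the sector system -/

section Final

variable {V : Type*} [AddCommGroup V] [Module ℝ V]

/-- The hyperplanes of `A` that do not contain `X`. -/
abbrev SlantIndex (A : HyperplaneArrangement ℝ V) (X : Submodule ℝ V) : Type _ :=
  {H : Submodule ℝ V // H ∈ A.hyperplanes ∧ ¬X ≤ H}

instance (A : HyperplaneArrangement ℝ V) (X : Submodule ℝ V) : Finite (SlantIndex A X) :=
  (A.finite.subset fun _ h => h.1 : {H | H ∈ A.hyperplanes ∧ ¬X ≤ H}.Finite).to_subtype

/-- Coordinates in which `X` is the third axis. The hyperplanes through `X` are enumerated by their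
angles, modulo `π`. -/
structure AxialCoordinates (A : HyperplaneArrangement ℝ V) (X : Submodule ℝ V) (n : ℤ) where
  basis : Module.Basis (Fin 3) ℝ V
  eq_span : X = Submodule.span ℝ {basis 2}
  angle : ℤ → ℝ
  strictMono : StrictMono angle
  angle_add : ∀ k, angle (k + n) = angle k + π
  axial_mem : ∀ k, axialHyperplane basis (angle k) ∈ A.hyperplanes
  exists_axial_eq : ∀ H ∈ A.hyperplanes, X ≤ H → ∃ k, H = axialHyperplane basis (angle k)
  slope : SlantIndex A X → ℝ × ℝ
  eq_slant : ∀ s, s.1 = slantHyperplane basis (slope s)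

theorem nonempty_axialCoordinates [FiniteDimensional ℝ V] (hV : Module.finrank ℝ V = 3)
    (A : HyperplaneArrangement ℝ V) {X : Submodule ℝ V} (hX : Module.finrank ℝ (V ⧸ X) = 2)
    (hn : 0 < (A.localization X).card) :
    Nonempty (AxialCoordinates A X (A.localization X).card) := by
  obtain ⟨b, hb⟩ := exists_basis_adapted hV hX
  have hax : ∀ H ∈ A.hyperplanes, X ≤ H → ∃ θ ∈ Set.Ico 0 π, H = axialHyperplane b θ := by
    intro H hH hXH
    obtain ⟨c, hc, rfl⟩ := exists_formOfBasis_ker_eq b (A.codim_one H hH)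
    rw [hb, span_le_ker_formOfBasis_iff] at hXH
    exact exists_axialHyperplane_eq b hc hXH
  have hsl : ∀ s : SlantIndex A X, ∃ p, s.1 = slantHyperplane b p := by
    rintro ⟨H, hH, hXH⟩
    obtain ⟨c, hc, rfl⟩ := exists_formOfBasis_ker_eq b (A.codim_one H hH)
    rw [hb, span_le_ker_formOfBasis_iff] at hXH
    exact exists_slantHyperplane_eq b hXH
  choose p hp using hsl
  have hinj : Set.InjOn (axialHyperplane b) (Set.Ico 0 π) := by
    intro θ hθ θ' hθ' h
    have hs := sin_sub_eq_zero_of_axialHyperplane_eq b h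
    rw [sin_eq_zero_iff_of_lt_of_lt (by linarith [hθ.1, hθ'.2]) (by linarith [hθ.2, hθ'.1])] at hs
    linarith
  have himg : axialHyperplane b '' {θ | θ ∈ Set.Ico 0 π ∧ axialHyperplane b θ ∈ A.hyperplanes} =
      (A.localization X).hyperplanes := by
    ext H
    constructor
    · rintro ⟨θ, ⟨-, hA⟩, rfl⟩
      refine ⟨hA, ?_⟩
      rw [hb, axialHyperplane, span_le_ker_formOfBasis_iff]
      rfl
    · rintro ⟨hA, hXH⟩
      obtain ⟨θ, hθ, rfl⟩ := hax H hA hXH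
      exact ⟨θ, ⟨hθ, hA⟩, rfl⟩
  have hinj' : Set.InjOn (axialHyperplane b)
      {θ | θ ∈ Set.Ico 0 π ∧ axialHyperplane b θ ∈ A.hyperplanes} := hinj.mono fun _ h => h.1
  have hfin : {θ | θ ∈ Set.Ico 0 π ∧ axialHyperplane b θ ∈ A.hyperplanes}.Finite :=
    Set.Finite.of_finite_image (himg ▸ (A.localization X).finite) hinj'
  have hcard : hfin.toFinset.card = (A.localization X).card := by
    rw [card, ← himg, hinj'.ncard_image, Set.ncard_eq_toFinset_card _ hfin]
  obtain ⟨θ, hmono, hadd, h1, h2⟩ := exists_angle_enumeration hfin.toFinset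
    (fun x hx => ((Set.Finite.mem_toFinset hfin).1 hx).1) (by omega)
  refine ⟨⟨b, hb, θ, hmono, by rw [← hcard]; exact hadd, fun k => ?_, fun H hH hXH => ?_, p, hp⟩⟩
  · obtain ⟨x, hx, m, hm⟩ := h1 k
    rw [hm, axialHyperplane_add_int_mul_pi]
    exact ((Set.Finite.mem_toFinset hfin).1 hx).2
  · obtain ⟨x, hx, rfl⟩ := hax H hH hXH
    obtain ⟨k, hk⟩ := h2 x ((Set.Finite.mem_toFinset hfin).2 ⟨hx, hH⟩)
    exact ⟨k, by rw [hk]⟩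

theorem two_le_card_localization (A : HyperplaneArrangement ℝ V) {X : Submodule ℝ V}
    (hX : X ∈ A.flatsOfRank 2) : 2 ≤ (A.localization X).card := by
  obtain ⟨⟨S, hS, rfl⟩, h2⟩ := hX
  by_contra! hlt
  have hsub : S ⊆ (A.localization (sInf S)).hyperplanes := fun H hH => ⟨hS hH, sInf_le hH⟩
  have : Finite (A.localization (sInf S)).hyperplanes := (A.localization (sInf S)).finite
  have hS1 := Set.ncard_le_one_iff_subsingleton.1 (Nat.lt_succ_iff.1 hlt)
  rcases (hS1.anti hsub).eq_empty_or_singleton with rfl | ⟨H, rfl⟩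
  · have h0 : (sInf ∅ : Submodule ℝ V) = ⊤ := sInf_empty
    rw [h0, Module.finrank_zero_of_subsingleton] at h2
    omega
  · have h0 : (sInf {H} : Submodule ℝ V) = H := sInf_singleton
    rw [h0, A.codim_one H (hS rfl)] at h2
    omega

namespace AxialCoordinates

variable {A : HyperplaneArrangement ℝ V} {X : Submodule ℝ V} {n : ℤ} (D : AxialCoordinates A X n)

theorem le_axialHyperplane (θ : ℝ) : X ≤ axialHyperplane D.basis θ := by
  refine D.eq_span.le.trans ?_
  rw [axialHyperplane, span_le_ker_formOfBasis_iff]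
  rfl

theorem slope_injective : Function.Injective D.slope := fun s t h =>
  Subtype.ext (by rw [D.eq_slant, D.eq_slant, h])

theorem axialHyperplane_eq_of_dvd {k j : ℤ} (h : n ∣ k - j) :
    axialHyperplane D.basis (D.angle k) = axialHyperplane D.basis (D.angle j) := by
  obtain ⟨m, hm⟩ := h
  rw [show k = j + n * m by omega, angle_add_mul D.angle_add, axialHyperplane_add_int_mul_pi]

/-- For distinct `s` and `t`, `X + (s ∩ t)` is a proper subspace and, by modularity, a flat. It
therefore lies in a hyperplane of `A` through `X`, and the two sinusoids agree at the angle of that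
hyperplane. -/
theorem exists_sinusoid_eq (hmod : A.IsModular X) (s t : SlantIndex A X) :
    ∃ j, sinusoid (D.slope s) (D.angle j) = sinusoid (D.slope t) (D.angle j) := by
  rcases eq_or_ne s t with rfl | hst
  · exact ⟨0, rfl⟩
  obtain ⟨S, hS, hSX⟩ := hmod.2 (s.1 ⊓ t.1)
    ⟨{s.1, t.1}, by rintro _ (rfl | rfl); exacts [s.2.1, t.2.1], by simp⟩
  set d := D.slope s - D.slope t with hd
  have hd0 : d ≠ 0 := sub_ne_zero.2 (D.slope_injective.ne hst)
  have hle : X ⊔ (s.1 ⊓ t.1) ≤ LinearMap.ker (formOfBasis D.basis ![d.1, d.2, 0]) := by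
    refine sup_le (D.eq_span.le.trans ((span_le_ker_formOfBasis_iff _ _).2 rfl)) ?_
    rintro v ⟨h1, h2⟩
    rw [SetLike.mem_coe, D.eq_slant, slantHyperplane, LinearMap.mem_ker] at h1 h2
    have : ![d.1, d.2, 0] = ![(D.slope s).1, (D.slope s).2, 1] -
        ![(D.slope t).1, (D.slope t).2, 1] := by
      funext i
      fin_cases i <;> simp [hd]
    rw [LinearMap.mem_ker, this, map_sub, LinearMap.sub_apply, h1, h2, sub_zero]
  obtain ⟨H, hH⟩ : S.Nonempty := by
    by_contra hS0
    have h0 : (sInf ∅ : Submodule ℝ V) = ⊤ := sInf_empty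
    rw [Set.not_nonempty_iff_eq_empty.1 hS0, h0] at hSX
    rw [hSX, top_le_iff, LinearMap.ker_eq_top, LinearEquiv.map_eq_zero_iff] at hle
    exact hd0 (Prod.ext (congrFun hle 0) (congrFun hle 1))
  have hXH : X ⊔ (s.1 ⊓ t.1) ≤ H := hSX ▸ sInf_le hH
  obtain ⟨j, rfl⟩ := D.exists_axial_eq H (hS hH) (le_sup_left.trans hXH)
  refine ⟨j, ?_⟩
  -- Up to sign, the cross product of the two normals.
  have hy : D.basis.equivFun.symm ![-d.2, d.1,
      (D.slope s).1 * d.2 - (D.slope s).2 * d.1] ∈ s.1 ⊓ t.1 := by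
    constructor <;>
      rw [SetLike.mem_coe, D.eq_slant, slantHyperplane, LinearMap.mem_ker,
        formOfBasis_equivFun_symm] <;>
      simp only [Matrix.cons_val, hd, Prod.fst_sub, Prod.snd_sub] <;> ring
  have := hXH (le_sup_right (a := X) hy)
  rw [axialHyperplane, LinearMap.mem_ker, formOfBasis_equivFun_symm] at this
  rw [← sub_eq_zero, ← sinusoid_sub, ← hd, sinusoid]
  simp only [Matrix.cons_val] at this
  linarith

/-- If the two sinusoids were apart at both ends, the cone over the sector between their hyperplanes
would have four facets and meet no hyperplane, against `card_le_finrank` in dimension three. -/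
theorem sinusoid_eq_of_adjacent [TopologicalSpace V] [IsTopologicalAddGroup V]
    [ContinuousSMul ℝ V] (hV : Module.finrank ℝ V = 3) (hn : 2 ≤ n) (hA : A.IsSimplicial)
    (hmod : A.IsModular X) (k : ℤ) (s t : SlantIndex A X)
    (h : sinusoid (D.slope t) ((D.angle k + D.angle (k + 1)) / 2) <
      sinusoid (D.slope s) ((D.angle k + D.angle (k + 1)) / 2))
    (hr : ∀ r, ¬(sinusoid (D.slope t) ((D.angle k + D.angle (k + 1)) / 2) <
        sinusoid (D.slope r) ((D.angle k + D.angle (k + 1)) / 2) ∧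
      sinusoid (D.slope r) ((D.angle k + D.angle (k + 1)) / 2) <
        sinusoid (D.slope s) ((D.angle k + D.angle (k + 1)) / 2))) :
    sinusoid (D.slope s) (D.angle k) = sinusoid (D.slope t) (D.angle k) ∨
      sinusoid (D.slope s) (D.angle (k + 1)) = sinusoid (D.slope t) (D.angle (k + 1)) := by
  set α := D.angle k with hα
  set β := D.angle (k + 1) with hβ
  set μ := (α + β) / 2 with hμ
  have hαβ : α < β := D.strictMono (lt_add_one k)
  have hβα : β < α + π := by
    rw [hα, ← D.angle_add]; exact D.strictMono (by omega)
  have hμI : μ ∈ Set.Ioo α β := ⟨by linarith, by linarith⟩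
  have hclos : closure (Set.Ioo α β) = Set.Icc α β := closure_Ioo hαβ.ne
  obtain ⟨j, hj⟩ := D.exists_sinusoid_eq hmod t s
  have hle : ∀ x ∈ Set.Icc α β, sinusoid (D.slope t) x ≤ sinusoid (D.slope s) x := fun x hx =>
    le_on_closure (s := Set.Ioo α β)
      (fun y hy => (sinusoid_lt_of_mem_Ioo D.strictMono D.angle_add hj hμI hy h).le)
      (continuous_sinusoid _).continuousOn (continuous_sinusoid _).continuousOn (hclos ▸ hx)
  by_contra! hne
  have hα' : sinusoid (D.slope t) α < sinusoid (D.slope s) α :=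
    lt_of_le_of_ne (hle α ⟨le_rfl, hαβ.le⟩) hne.1.symm
  have hβ' : sinusoid (D.slope t) β < sinusoid (D.slope s) β :=
    lt_of_le_of_ne (hle β ⟨hαβ.le, le_rfl⟩) hne.2.symm
  let g : Fin 4 → Module.Dual ℝ V :=
    ![formOfBasis D.basis ![-sin α, cos α, 0], -formOfBasis D.basis ![-sin β, cos β, 0],
      formOfBasis D.basis ![(D.slope s).1, (D.slope s).2, 1],
      -formOfBasis D.basis ![(D.slope t).1, (D.slope t).2, 1]]
  let avg : ℝ → ℝ := fun x => (sinusoid (D.slope s) x + sinusoid (D.slope t) x) / 2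
  -- One relative interior point of each facet: on the two walls at the mean height, and on the two
  -- slanted hyperplanes over the middle of the sector.
  let w : Fin 4 → V :=
    ![cylinderPoint D.basis α (-avg α), cylinderPoint D.basis β (-avg β),
      cylinderPoint D.basis μ (-sinusoid (D.slope s) μ),
      cylinderPoint D.basis μ (-sinusoid (D.slope t) μ)]
  have g0 : ∀ x z, g 0 (cylinderPoint D.basis x z) = sin (x - α) := fun x z =>
    axialForm_cylinderPoint _ _ _ _
  have g1 : ∀ x z, g 1 (cylinderPoint D.basis x z) = sin (β - x) := fun x z => by
    rw [← neg_sub, sin_neg, ← axialForm_cylinderPoint D.basis β x z]; rfl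
  have g2 : ∀ x z, g 2 (cylinderPoint D.basis x z) = sinusoid (D.slope s) x + z := fun x z =>
    slantForm_cylinderPoint _ _ _ _
  have g3 : ∀ x z, g 3 (cylinderPoint D.basis x z) = -(sinusoid (D.slope t) x + z) := fun x z => by
    rw [← slantForm_cylinderPoint D.basis]; rfl
  have s1 : 0 < sin (μ - α) := sin_pos_of_pos_of_lt_pi (by linarith) (by linarith)
  have s2 : 0 < sin (β - μ) := sin_pos_of_pos_of_lt_pi (by linarith) (by linarith)
  have s3 : 0 < sin (β - α) := sin_pos_of_pos_of_lt_pi (by linarith) (by linarith)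
  have hcard := hA.card_le_finrank g (cylinderPoint D.basis μ (-avg μ)) ?_ ?_ w ?_ ?_ ?_
  · rw [hV] at hcard
    simp at hcard
  · intro j
    fin_cases j
    · exact (g0 _ _).symm ▸ s1
    · exact (g1 _ _).symm ▸ s2
    · refine (g2 _ _).symm ▸ ?_
      simp only [avg]; linarith
    · refine (g3 _ _).symm ▸ ?_
      simp only [avg]; linarith
  -- A hyperplane through `X` would give a wall strictly inside the sector. Any other would give a
  -- sinusoid strictly between those of `t` and `s` at `ψ`, hence also at the middle `μ`, against
  -- `hr`.
  · intro v hv H hH hvH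
    have v0 := hv 0
    have v1 := hv 1
    have v2 := hv 2
    have v3 := hv 3
    change 0 < formOfBasis D.basis _ v at v0 v2
    change 0 < -formOfBasis D.basis _ v at v1 v3
    rw [formOfBasis_apply] at v0 v1 v2 v3
    set x := D.basis.equivFun v 0
    set y := D.basis.equivFun v 1
    set z := D.basis.equivFun v 2
    simp only [Matrix.cons_val] at v0 v1 v2 v3
    obtain ⟨r, ψ, hr0, hψ, hx, hy⟩ := exists_polar (x := x) (y := y) hαβ (by linarith)
      (by linarith)
    by_cases hXH : X ≤ H
    · obtain ⟨i, rfl⟩ := D.exists_axial_eq H hH hXH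
      rw [axialHyperplane, LinearMap.mem_ker, formOfBasis_apply] at hvH
      simp only [Matrix.cons_val] at hvH
      refine sin_sub_angle_ne_zero D.strictMono D.angle_add hψ i ?_
      have : r * sin (ψ - D.angle i) = 0 := by
        rw [← hvH, sin_sub]
        change _ = -sin (D.angle i) * x + cos (D.angle i) * y + 0 * z
        rw [hx, hy]; ring
      exact (mul_eq_zero.1 this).resolve_left hr0.ne'
    · have hvu : v ∈ slantHyperplane D.basis (D.slope ⟨H, hH, hXH⟩) := by
        rw [← D.eq_slant]; exact hvH
      set u : SlantIndex A X := ⟨H, hH, hXH⟩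
      rw [slantHyperplane, LinearMap.mem_ker, formOfBasis_apply] at hvu
      simp only [Matrix.cons_val] at hvu
      change (D.slope u).1 * x + (D.slope u).2 * y + 1 * z = 0 at hvu
      have e : ∀ p : ℝ × ℝ, p.1 * x + p.2 * y = r * sinusoid p ψ := fun p => by
        rw [hx, hy, sinusoid]; ring
      rw [e] at v2 v3 hvu
      have l1 : sinusoid (D.slope t) ψ < sinusoid (D.slope u) ψ :=
        lt_of_mul_lt_mul_left (by linarith) hr0.le
      have l2 : sinusoid (D.slope u) ψ < sinusoid (D.slope s) ψ :=
        lt_of_mul_lt_mul_left (by linarith) hr0.le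
      obtain ⟨j1, hj1⟩ := D.exists_sinusoid_eq hmod t u
      obtain ⟨j2, hj2⟩ := D.exists_sinusoid_eq hmod u s
      exact hr u ⟨sinusoid_lt_of_mem_Ioo D.strictMono D.angle_add hj1 hψ hμI l1,
        sinusoid_lt_of_mem_Ioo D.strictMono D.angle_add hj2 hψ hμI l2⟩
  · intro j
    fin_cases j
    · exact (g0 _ _).trans (by simp)
    · exact (g1 _ _).trans (by simp)
    · exact (g2 _ _).trans (by simp)
    · exact (g3 _ _).trans (by simp)
  · intro j l hl
    fin_cases j <;> fin_cases l <;> first | exact absurd rfl hl | skip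
    · exact (g1 _ _).symm ▸ s3
    · refine (g2 _ _).symm ▸ ?_
      simp only [avg]; linarith
    · refine (g3 _ _).symm ▸ ?_
      simp only [avg]; linarith
    · exact (g0 _ _).symm ▸ s3
    · refine (g2 _ _).symm ▸ ?_
      simp only [avg]; linarith
    · refine (g3 _ _).symm ▸ ?_
      simp only [avg]; linarith
    · exact (g0 _ _).symm ▸ s1
    · exact (g1 _ _).symm ▸ s2
    · refine (g3 _ _).symm ▸ ?_
      linarith
    · exact (g0 _ _).symm ▸ s1
    · exact (g1 _ _).symm ▸ s2
    · refine (g2 _ _).symm ▸ ?_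
      linarith
  · intro j hj
    fin_cases j
    · exact hj _ (D.axial_mem k) ((cylinderPoint_mem_axialHyperplane _).2 (by simp [← hα]))
    · exact hj _ (D.axial_mem (k + 1)) ((cylinderPoint_mem_axialHyperplane _).2 (by simp [← hβ]))
    · exact hj s.1 s.2.1 (by
        rw [D.eq_slant]; exact (cylinderPoint_mem_slantHyperplane _).2 (by simp))
    · exact hj t.1 t.2.1 (by
        rw [D.eq_slant]; exact (cylinderPoint_mem_slantHyperplane _).2 (by simp))

/-- The system of sectors between the hyperplanes through `X`. -/
noncomputable def sectorSystem [TopologicalSpace V] [IsTopologicalAddGroup V]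
    [ContinuousSMul ℝ V] (hV : Module.finrank ℝ V = 3) (hn : 2 ≤ n) (hA : A.IsSimplicial)
    (hmod : A.IsModular X) : SectorSystem (SlantIndex A X) n :=
  sectorSystemOfSinusoids D.strictMono D.angle_add D.slope D.slope_injective
    (fun s t _ => D.exists_sinusoid_eq hmod s t) (D.sinusoid_eq_of_adjacent hV hn hA hmod)

theorem axialHyperplane_ne_bot (θ : ℝ) : axialHyperplane D.basis θ ≠ ⊥ := fun h => by
  have h1 := D.le_axialHyperplane θ
  rw [h, le_bot_iff] at h1
  exact D.basis.ne_zero 2 (Submodule.span_singleton_eq_bot.1 (D.eq_span.symm.trans h1))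

/-- With no slanted hyperplane the center would contain `X`; with a single one, the axis vector lies
in all hyperplanes but that one, and `A` splits. -/
theorem nontrivial_slantIndex (D : AxialCoordinates A X n) (hV : Module.finrank ℝ V = 3) (hirr : A.IsIrreducible)
    (hrank : A.rank = Module.finrank ℝ V) : Nontrivial (SlantIndex A X) := by
  have hq : D.basis 2 ∈ X :=
    D.eq_span.symm.le (Submodule.mem_span_singleton_self _)
  have : FiniteDimensional ℝ V := FiniteDimensional.of_finrank_pos (by omega)
  by_contra hnt
  rw [not_nontrivial_iff_subsingleton] at hnt
  rcases isEmpty_or_nonempty (SlantIndex A X) with he | ⟨⟨s⟩⟩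
  · have hc : X ≤ A.center := le_sInf fun H hH => by
      by_contra hXH
      exact he.elim ⟨H, hH, hXH⟩
    have h0 : A.center = ⊥ := by
      have := A.center.finrank_quotient_add_finrank
      rw [rank] at hrank
      exact Submodule.finrank_eq_zero.1 (by omega)
    exact D.basis.ne_zero 2 ((Submodule.mem_bot ℝ).1 (h0 ▸ hc hq))
  · refine hirr (A.isReducible_of_forall_ne_mem s.2.1 (fun h0 => ?_) (q := D.basis 2)
      (fun h => s.2.2 ?_) fun H hH hne => ?_)
    · have h1 := A.codim_one _ s.2.1
      have h2 := s.1.finrank_quotient_add_finrank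
      rw [h1, hV, h0, finrank_bot] at h2
      omega
    · rw [← Submodule.span_singleton_le_iff_mem] at h
      exact D.eq_span.le.trans h
    · by_contra hqH
      have hXH : ¬X ≤ H := fun h => hqH (h hq)
      exact hne (congrArg Subtype.val (Subsingleton.elim (⟨H, hH, hXH⟩ : SlantIndex A X) s))

/-- For `n = 2` the common point of the slanted hyperplanes above the direction `angle ε` lies in
every hyperplane except the one at `angle (ε + 1)`, so `A` splits. -/
theorem ne_two_of_isIrreducible (hirr : A.IsIrreducible) {ε : ℤ} {w : ℝ}
    (h : ∀ t, sinusoid (D.slope t) (D.angle ε) = w) : n ≠ 2 := by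
  rintro rfl
  refine hirr (A.isReducible_of_forall_ne_mem (D.axial_mem (ε + 1)) (D.axialHyperplane_ne_bot _)
    (q := cylinderPoint D.basis (D.angle ε) (-w)) ?_ ?_)
  · rw [cylinderPoint_mem_axialHyperplane, sin_angle_sub_eq_zero_iff D.strictMono D.angle_add]
    omega
  · intro H hH hne
    by_cases hXH : X ≤ H
    · obtain ⟨j, rfl⟩ := D.exists_axial_eq H hH hXH
      rw [cylinderPoint_mem_axialHyperplane, sin_angle_sub_eq_zero_iff D.strictMono D.angle_add]
      by_contra hd
      exact hne (D.axialHyperplane_eq_of_dvd (by omega))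
    · have hH' : H = slantHyperplane D.basis (D.slope ⟨H, hH, hXH⟩) :=
        D.eq_slant ⟨H, hH, hXH⟩
      rw [hH', cylinderPoint_mem_slantHyperplane, h, add_neg_cancel]

end AxialCoordinates

theorem latticeEquivalent_of_hasPolygonIncidences {W : Type*} [AddCommGroup W] [Module ℝ W]
    (b : Module.Basis (Fin 3) ℝ V) (b' : Module.Basis (Fin 3) ℝ W) {n : ℕ} (hn : 2 ≤ n)
    {θ θ' : Fin n → ℝ} {p p' : Fin n → ℝ × ℝ} (h : HasPolygonIncidences θ p)
    (h' : HasPolygonIncidences θ' p') (h0 : ∀ i, formOfBasis b (axialNormals θ p i) ≠ 0)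
    (h0' : ∀ i, formOfBasis b' (axialNormals θ' p' i) ≠ 0) :
    (ofForms _ h0).LatticeEquivalent (ofForms _ h0') := by
  refine latticeEquivalent_ofForms _ _ _ _ fun T j => ?_
  rw [iInf_ker_le_ker_iff_mem_span (fun i => formOfBasis b (axialNormals θ p i)),
    iInf_ker_le_ker_iff_mem_span (fun i => formOfBasis b' (axialNormals θ' p' i))]
  rw [← Set.image_image (formOfBasis b), ← Set.image_image (formOfBasis b')]
  exact ((Submodule.apply_mem_span_image_iff_mem_span (f := (formOfBasis b).toLinearMap)
    (formOfBasis b).injective).trans (h.mem_span_iff h' hn T j)).trans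
    (Submodule.apply_mem_span_image_iff_mem_span (f := (formOfBasis b').toLinearMap)
      (formOfBasis b').injective).symm

end Final

end HyperplaneArrangement

/-! ### The subarrangement cut out by the upper envelope -/

theorem mainTheorem8 {V : Type*} [AddCommGroup V] [Module ℝ V] [FiniteDimensional ℝ V]
    [TopologicalSpace V] [IsTopologicalAddGroup V] [ContinuousSMul ℝ V] [T2Space V]
    (hV : Module.finrank ℝ V = 3)
    (A : HyperplaneArrangement ℝ V)
    (hirr : A.IsIrreducible) (hss : A.IsSupersolvable) (hsimp : A.IsSimplicial)
    (X : Submodule ℝ V) (hX : X ∈ A.flatsOfRank 2) (hmod : A.IsModular X)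
    (n : ℕ) (hn : n = (A.localization X).card) :
    3 ≤ n ∧ ∃ B : HyperplaneArrangement ℝ V,
      B.IsSubarrangement A ∧ A.localization X = B.localization X ∧
        B.LatticeEquivalent (HyperplaneArrangement.A2n1 n) := by
  have h2 : 2 ≤ n := hn ▸ A.two_le_card_localization hX
  obtain ⟨D⟩ := HyperplaneArrangement.nonempty_axialCoordinates hV A hX.2 (by omega)
  rw [← hn] at D
  have hnt := D.nontrivial_slantIndex hV hirr hss.1
  obtain ⟨ε, S, hS, hwall, htwo⟩ := SectorSystem.exists_top_sequence (by exact_mod_cast h2)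
    (D.sectorSystem hV (by exact_mod_cast h2) hsimp hmod)
  have hn2 : n ≠ 2 := fun h => D.ne_two_of_isIrreducible hirr
    (fun t => (htwo (by exact_mod_cast h) t).symm) (by exact_mod_cast h)
  -- Renumbering the walls by `ε` and taking `S 0, …, S (n - 1)` makes the incidences literally
  -- those of `A2n1 n`.
  have hinc : HyperplaneArrangement.HasPolygonIncidences (fun k : Fin n => D.angle ((k : ℕ) + ε))
      (fun i => D.slope (S (i : ℕ))) := by
    constructor
    · intro k l hkl
      rw [Ne, sin_angle_sub_eq_zero_iff D.strictMono D.angle_add, add_sub_add_right_eq_sub]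
      exact fun h => hkl (HyperplaneArrangement.Fin.eq_of_intCast_dvd_sub h).symm
    · intro i j k hij
      rcases lt_or_gt_of_ne hij with hlt | hgt
      · exact hwall i j k (by exact_mod_cast hlt) (by omega)
      · rw [eq_comm, add_comm ((i : ℕ) : ℤ)]
        exact hwall j i k (by exact_mod_cast hgt) (by omega)
  have hne : ∀ i, HyperplaneArrangement.formOfBasis D.basis (HyperplaneArrangement.axialNormals (fun k : Fin n => D.angle ((k : ℕ) + ε))
      (fun i => D.slope (S (i : ℕ))) i) ≠ 0 := fun i =>
    (HyperplaneArrangement.formOfBasis D.basis).map_ne_zero_iff.2 (hinc.axialNormals_ne_zero h2 i)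
  refine ⟨by omega, HyperplaneArrangement.ofForms _ hne, ?_, ?_, ?_⟩
  · rintro _ ⟨k | i, rfl⟩
    · exact D.axial_mem _
    · change HyperplaneArrangement.slantHyperplane D.basis _ ∈ _
      rw [← D.eq_slant]
      exact (S i).2.1
  · ext H
    constructor
    · rintro ⟨hH, hXH⟩
      refine ⟨?_, hXH⟩
      obtain ⟨j, rfl⟩ := D.exists_axial_eq H hH hXH
      have hn0 : (0 : ℤ) < n := by omega
      have e1 := Int.emod_nonneg (j - ε) hn0.ne'
      have e2 := Int.emod_lt_of_pos (j - ε) hn0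
      -- Walls with congruent indices modulo `n` carry the same hyperplane, so the residue of `j -
      -- ε` is an admissible index.
      refine ⟨Sum.inl ⟨((j - ε) % n).toNat, by omega⟩, ?_⟩
      refine D.axialHyperplane_eq_of_dvd ?_
      rw [dvd_sub_comm]
      simp only [Int.toNat_of_nonneg e1]
      have := Int.dvd_self_sub_emod (x := j - ε) (m := n)
      rwa [show j - ((j - ε) % n + ε) = j - ε - (j - ε) % n by ring]
    · rintro ⟨⟨k | i, rfl⟩, hXH⟩
      · exact ⟨D.axial_mem _, hXH⟩
      · refine absurd hXH ?_
        change ¬ X ≤ HyperplaneArrangement.slantHyperplane D.basis _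
        rw [← D.eq_slant]
        exact (S i).2.2
  · have := HyperplaneArrangement.latticeEquivalent_of_hasPolygonIncidences D.basis (Pi.basisFun ℝ (Fin 3)) h2 hinc
      (HyperplaneArrangement.hasPolygonIncidences_A2n1 (by omega)) hne (by
        intro i
        rw [HyperplaneArrangement.axialNormals_eq_normalsA2n1, HyperplaneArrangement.formOfBasis_basisFun]
        exact HyperplaneArrangement.formOfNormal_ne_zero _ (HyperplaneArrangement.normalsA2n1_ne_zero n i))
    rw [HyperplaneArrangement.A2n1]
    simpa only [HyperplaneArrangement.axialNormals_eq_normalsA2n1, HyperplaneArrangement.formOfBasis_basisFun] using this
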